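/- Conventions. A represented space $\mathbf X=(X,\delta_X)$ is a set $X$ with a partial surjection $\delta_X:\subseteq\mathbb N^{\mathbb N}\to X$; $p$ is a name of $x$ if $\delta_X(p)=x$. A (partial, possibly multivalued) function $f:\subseteq\mathbf X\rightrightarrows\mathbf Y$ is computable (continuous) if some computable (continuous) partial function $F:\subseteq\mathbb N^{\mathbb N}\to\mathbb N^{\mathbb N}$ satisfies $\delta_Y(F(p))\in f(\delta_X(p))$ for all names $p$ of points of $\operatorname{dom} f$. The symbol $\cong$ denotes computable isomorphism (a bijection computable in both directions). A point is computable if it has a computable name. $\Sigma$ is Sierpiński space $\{\bot,\top\}$, represented by the total map under which $0^\omega$ is the only name of $\bot$; $\mathcal C(\mathbf X,\mathbf Y)$ is the function space, in which a name of a continuous function codes a continuous realizer of it; and $\mathcal O(\mathbf X)$ is $\mathcal C(\mathbf X,\Sigma)$, its elements being regarded as open subsets of $X$. $\mathcal V(\mathbf X)$, the space of overt sets, is the subspace of $\mathcal O(\mathcal O(\mathbf X))$ of all families whose characteristic functions preserve finite joins; a set $A\subseteq X$ (or equivalently its closure) determines the element $\{U\in\mathcal O(\mathbf X)\mid U\cap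 A\ne\emptyset\}$ of $\mathcal V(\mathbf X)$. A representation $\delta$ of $X$ is computably admissible if $\kappa:x\mapsto\{U\in\mathcal O(X,\delta)\mid x\in U\}$, from $(X,\delta)$ to $\mathcal O(\mathcal O(X,\delta))$, is injective with computable partial inverse. It is effectively fiber-overt if $x\mapsto\overline{\delta^{-1}(\{x\})}$ is computable from $(X,\delta)$ to $\mathcal V(\mathbb N^{\mathbb N})$. It is total if $\operatorname{dom}\delta=\mathbb N^{\mathbb N}$. The represented space $\mathbf X$ admits $\delta$ if $\delta$ is a representation of $X$ for which the identity on $X$ is computable in both directions between $\delta_X$ and $\delta$. $\mathbf X$ is effectively separable if there is a computable sequence $\mathbb N\to\mathbf X$ that meets every non-empty open set, and computably overt if $\{U\in\mathcal O(\mathbf X)\mid U\neq\emptyset\}$ is a computable point of $\mathcal V(\mathbf X)$. For a transitive relation $\prec$ on $\mathbb N$, a rounded ideal is a non-empty $I\subseteq\mathbb N$ such that $x\prec y\in I$ implies $x\in I$, and any $x,y\in I$ have some $z\in I$ with $x\prec z$ and $y\prec z$. $\mathrm{RI}(\prec)$ is the space of rounded ideals of $\prec$, as a subspace of the space of all subsets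 of $\mathbb N$ represented by enumerations. The extendability predicate of $\prec$ is the set $E$ of all $n\in\mathbb N$ that belong to some rounded ideal. $\mathbf X$ is precomputably quasi-Polish if $\mathbf X\cong\mathrm{RI}(\prec)$ for some c.e. transitive relation $\prec$ on $\mathbb N$. Theorem. For a non-empty represented space $\mathbf X$ the following are equivalent: (i) $\mathbf X$ is precomputably quasi-Polish and effectively separable; (ii) $\mathbf X$ is precomputably quasi-Polish and computably overt; (iii) $\mathbf X$ admits an effectively fiber-overt, computably admissible, total representation $\delta$; (iv) there is a c.e. transitive relation $\prec\ \subseteq\mathbb N\times\mathbb N$ with c.e. extendability predicate such that $\mathbf X\cong\mathrm{RI}(\prec)$. -/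

import Mathlib

/-! Represented spaces over Baire space `ℕ → ℕ`, computability and continuity of maps between them,
function spaces, hyperspaces of open and of overt sets, and spaces of rounded ideals. -/

namespace RepSpace

/-! ### Computability on Baire space -/

/-- The prefix `p(0) p(1) … p(n-1)` of `p`. -/
def pre (p : ℕ → ℕ) (n : ℕ) : List ℕ := (List.range n).map p

/-- The partial function on Baire space induced by a word function `h`, given by its graph:
`h` maps `p` to `q` if the words `h (p↾k)` are prefixes of `q` of unbounded length.
The computable partial functions on Baire space are exactly the restrictions of the functions
induced by computable word functions (type-two computability); the continuous ones are exactly the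
restrictions of the functions induced by arbitrary word functions. -/
def Yields (h : List ℕ → List ℕ) (p q : ℕ → ℕ) : Prop :=
  (∀ k, h (pre p k) = pre q (h (pre p k)).length) ∧ ∀ n, ∃ k, n ≤ (h (pre p k)).length

/-- The word function coded by a point of Baire space. -/
def wordFun (p : ℕ → ℕ) (w : List ℕ) : List ℕ :=
  Denumerable.ofNat (List ℕ) (p (Encodable.encode w))

/-! ### Represented spaces -/

/-- A representation of `X`: a partial surjection from Baire space onto `X`, given by its graph.
A represented space is a type together with a representation of it. -/
structure Representation (X : Type*) where
  /-- `Names p x`: the point `p` is in the domain and is mapped to `x`. -/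
  Names : (ℕ → ℕ) → X → Prop
  unique : ∀ {p x y}, Names p x → Names p y → x = y
  surj : ∀ x, ∃ p, Names p x

section Maps

variable {X Y : Type*}

/-- The partial function induced by `h` is a realizer of the partial multivalued function `f`
(with domain the set of all `x` with `f x` nonempty). -/
def Realizes (δX : Representation X) (δY : Representation Y) (h : List ℕ → List ℕ)
    (f : X → Set Y) : Prop :=
  ∀ p x, δX.Names p x → (f x).Nonempty → ∃ q, Yields h p q ∧ ∃ y ∈ f x, δY.Names q y

/-- Computability of a partial multivalued function between represented spaces. -/
def IsComputableMulti (δX : Representation X) (δY : Representation Y) (f : X → Set Y) : Prop :=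
  ∃ h, Computable h ∧ Realizes δX δY h f

/-- Computability of a function between represented spaces. -/
def IsComputable (δX : Representation X) (δY : Representation Y) (f : X → Y) : Prop :=
  IsComputableMulti δX δY fun x => {f x}

/-- Continuity of a function between represented spaces: it has a continuous realizer. -/
def IsContinuous (δX : Representation X) (δY : Representation Y) (f : X → Y) : Prop :=
  ∃ h, Realizes δX δY h fun x => {f x}

/-- A point is computable if it has a computable name. -/
def IsComputablePoint (δX : Representation X) (x : X) : Prop :=
  ∃ p, Computable p ∧ δX.Names p x

/-- Computable isomorphism of represented spaces. -/
def ComputablyIsomorphic (δX : Representation X) (δY : Representation Y) : Prop :=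
  ∃ e : X ≃ Y, IsComputable δX δY e ∧ IsComputable δY δX e.symm

/-- Two representations of the same set are equivalent if they describe the same represented space,
i.e. if the identity is computable in both directions. -/
def Equivalent (δ δ' : Representation X) : Prop :=
  IsComputable δ δ' id ∧ IsComputable δ' δ id

/-- A representation is total if every point of Baire space is a name. -/
def Representation.IsTotal (δ : Representation X) : Prop := ∀ p, ∃ x, δ.Names p x

/-- The subspace of a represented space given by a predicate. -/
def Representation.subspace (δ : Representation X) (P : X → Prop) :
    Representation {x // P x} where
  Names p x := δ.Names p x.1
  unique h h' := Subtype.ext (δ.unique h h')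
  surj x := δ.surj x.1

end Maps

/-- Baire space as a represented space. -/
def baire : Representation (ℕ → ℕ) where
  Names p q := p = q
  unique h h' := h.symm.trans h'
  surj q := ⟨q, rfl⟩

/-- The natural numbers as a represented space. -/
def nat : Representation ℕ where
  Names p n := p 0 = n
  unique h h' := h.symm.trans h'
  surj n := ⟨fun _ => n, rfl⟩

/-- Sierpiński space: the truth values, where the only name of `False` is the zero sequence. -/
def sierpinski : Representation Prop where
  Names p s := s ↔ ∃ n, p n ≠ 0
  unique h h' := propext (h.trans h'.symm)
  surj s := by
    by_cases hs : s
    · exact ⟨fun _ => 1, by simp [hs]⟩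
    · exact ⟨fun _ => 0, by simp [hs]⟩

/-- The space of all subsets of `ℕ`, represented by enumerations (`n + 1` lists `n`, and `0` lists
nothing). -/
def enumNat : Representation (Set ℕ) where
  Names p A := ∀ n, n ∈ A ↔ ∃ i, p i = n + 1
  unique h h' := Set.ext fun n => (h n).trans (h' n).symm
  surj A := by
    classical
    refine ⟨fun i => if i ∈ A then i + 1 else 0, fun n => ⟨fun hn => ⟨n, by simp [hn]⟩, ?_⟩⟩
    rintro ⟨i, hi⟩
    by_cases h : i ∈ A
    · simp only [h, if_true] at hi
      obtain rfl : i = n := by omega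
      exact h
    · simp [h] at hi

/-! ### Function spaces, open sets and overt sets -/

section Hyperspaces

variable {X Y : Type*}

theorem length_pre (p : ℕ → ℕ) (n : ℕ) : (pre p n).length = n := by simp [pre]

theorem getElem?_pre {p : ℕ → ℕ} {n i : ℕ} (h : i < n) : (pre p n)[i]? = some (p i) := by
  simp [pre, h]

theorem take_pre {p : ℕ → ℕ} {n i : ℕ} (h : i ≤ n) : (pre p n).take i = pre p i := by
  apply List.ext_getElem? fun j => ?_
  rw [List.getElem?_take]
  simp only [pre, List.getElem?_map]
  split_ifs <;> grind

theorem Yields.unique {h : List ℕ → List ℕ} {p q q' : ℕ → ℕ} (H : Yields h p q)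
    (H' : Yields h p q') : q = q' := by
  funext n
  obtain ⟨k, hk⟩ := H.2 (n + 1)
  have e : pre q (h (pre p k)).length = pre q' (h (pre p k)).length :=
    (H.1 k).symm.trans (H'.1 k)
  have := congrArg (fun l => l[n]?) e
  simpa [getElem?_pre hk] using this

/-- Continuous functions between represented spaces. -/
def ContMap (δX : Representation X) (δY : Representation Y) : Type _ :=
  {f : X → Y // IsContinuous δX δY f}

/-- The function space: `p` is a name of `f` if the partial function on Baire space coded by `p` is
a realizer of `f`. -/
def funcSpace (δX : Representation X) (δY : Representation Y) :
    Representation (ContMap δX δY) where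
  Names p f := Realizes δX δY (wordFun p) fun x => {f.1 x}
  unique {p f g} hf hg := by
    apply Subtype.ext
    funext x
    obtain ⟨q, hq⟩ := δX.surj x
    obtain ⟨r, hr, y, rfl, hry⟩ := hf q x hq ⟨_, rfl⟩
    obtain ⟨r', hr', y', rfl, hry'⟩ := hg q x hq ⟨_, rfl⟩
    cases hr.unique hr'
    exact δY.unique hry hry'
  surj f := by
    obtain ⟨h, hh⟩ := f.2
    refine ⟨fun n => Encodable.encode (h (Denumerable.ofNat (List ℕ) n)), ?_⟩
    have : wordFun (fun n => Encodable.encode (h (Denumerable.ofNat (List ℕ) n))) = h := by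
      funext w
      simp [wordFun]
    rw [this]
    exact hh

/-- The open subsets of a represented space, i.e. the continuous functions to Sierpiński space. -/
abbrev Opens (δ : Representation X) : Type _ := ContMap δ sierpinski

/-- The represented space of open subsets. -/
abbrev opens (δ : Representation X) : Representation (Opens δ) := funcSpace δ sierpinski

theorem isContinuous_hits (δ : Representation X) (A : Set X) :
    IsContinuous (opens δ) sierpinski fun U => ∃ x ∈ A, U.1 x := by
  classical
  let Good : List ℕ → Prop := fun v => ∃ x ∈ A, ∃ q, δ.Names q x ∧ ∃ k j,
    v[Encodable.encode (pre q k)]? = some j ∧ ∃ m ∈ Denumerable.ofNat (List ℕ) j, m ≠ 0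
  let h : List ℕ → List ℕ := fun w =>
    (List.range w.length).map fun i => if Good (w.take i) then 1 else 0
  have hpre : ∀ p k, h (pre p k) = pre (fun i => if Good (pre p i) then 1 else 0) k := by
    intro p k
    simp only [h, length_pre]
    unfold pre
    refine List.map_congr_left fun i hi => ?_
    have := take_pre (p := p) (List.mem_range.1 hi).le
    unfold pre at this
    rw [this]
  refine ⟨h, fun p U hU _ => ⟨fun i => if Good (pre p i) then 1 else 0,
    ⟨fun k => ?_, fun n => ⟨n, ?_⟩⟩, _, rfl, ?_⟩⟩
  · rw [hpre, length_pre]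
  · rw [hpre, length_pre]
  · change (∃ x ∈ A, U.1 x) ↔ ∃ n, (if Good (pre p n) then 1 else 0) ≠ 0
    have key : ∀ q x, δ.Names q x → (U.1 x ↔ ∃ k, ∃ m ∈ wordFun p (pre q k), m ≠ 0) := by
      intro q x hq
      obtain ⟨r, hr, y, rfl, hry⟩ := hU q x hq ⟨_, rfl⟩
      refine Iff.trans hry ⟨?_, ?_⟩
      · rintro ⟨n, hn⟩
        obtain ⟨k, hk⟩ := hr.2 (n + 1)
        refine ⟨k, r n, ?_, hn⟩
        rw [hr.1 k]
        exact List.mem_of_getElem? (getElem?_pre hk)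
      · rintro ⟨k, m, hm, hm0⟩
        rw [hr.1 k] at hm
        obtain ⟨i, -, rfl⟩ := List.mem_map.1 hm
        exact ⟨i, hm0⟩
    constructor
    · rintro ⟨x, hxA, hx⟩
      obtain ⟨q, hq⟩ := δ.surj x
      obtain ⟨k, m, hm, hm0⟩ := (key q x hq).1 hx
      refine ⟨Encodable.encode (pre q k) + 1, ?_⟩
      have : Good (pre p (Encodable.encode (pre q k) + 1)) :=
        ⟨x, hxA, q, hq, k, _, getElem?_pre (Nat.lt_succ_self _), m, hm, hm0⟩
      simp [this]
    · rintro ⟨n, hn⟩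
      have hG : Good (pre p n) := by
        by_contra hG
        simp [hG] at hn
      obtain ⟨x, hxA, q, hq, k, j, hj, m, hm, hm0⟩ := hG
      refine ⟨x, hxA, (key q x hq).2 ⟨k, m, ?_, hm0⟩⟩
      have hlt : Encodable.encode (pre q k) < n := by
        have := (List.getElem?_eq_some_iff.1 hj).1
        rwa [length_pre] at this
      rw [getElem?_pre hlt] at hj
      cases hj
      exact hm

/-- A family of open sets is join-preserving if its characteristic function preserves the empty
join and binary joins. -/
def JoinPreserving {δ : Representation X} (W : Opens (opens δ)) : Prop :=
  (∀ U : Opens δ, (∀ x, ¬ U.1 x) → ¬ W.1 U) ∧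
    ∀ U V T : Opens δ, (∀ x, T.1 x ↔ U.1 x ∨ V.1 x) → (W.1 T ↔ W.1 U ∨ W.1 V)

/-- The overt subsets of a represented space, as join-preserving families of open sets. -/
abbrev Overt (δ : Representation X) : Type _ := {W : Opens (opens δ) // JoinPreserving W}

/-- The represented space of overt subsets, a subspace of the open families of open sets. -/
abbrev overts (δ : Representation X) : Representation (Overt δ) :=
  (opens (opens δ)).subspace JoinPreserving

/-- The overt set given by (the closure of) `A`: the family of all open sets that meet `A`. -/
def hits (δ : Representation X) (A : Set X) : Overt δ :=
  ⟨⟨fun U => ∃ x ∈ A, U.1 x, isContinuous_hits δ A⟩,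
    fun U hU ⟨x, _, hx⟩ => hU x hx, fun U V T hT => by
      change (∃ x ∈ A, T.1 x) ↔ (∃ x ∈ A, U.1 x) ∨ ∃ x ∈ A, V.1 x
      simp only [hT, and_or_left, exists_or]⟩

/-- The neighbourhood filter `{U | x ∈ U}` of a point, as an open family of open sets. -/
def nhdFilter (δ : Representation X) (x : X) : Opens (opens δ) :=
  ⟨fun U => U.1 x, by simpa using isContinuous_hits δ {x}⟩

/-! ### Properties of represented spaces and of representations -/

/-- Computable admissibility: the canonical map `x ↦ {U | x ∈ U}` from the space to the open
families of open sets is injective and its partial inverse is computable. -/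
def ComputablyAdmissible (δ : Representation X) : Prop :=
  Function.Injective (nhdFilter δ) ∧
    IsComputableMulti (opens (opens δ)) δ fun W => {x | nhdFilter δ x = W}

/-- Effective fiber-overtness: from `x` one can compute the closure of the set of names of `x` as an
overt subset of Baire space. -/
def EffectivelyFiberOvert (δ : Representation X) : Prop :=
  IsComputable δ (overts baire) fun x => hits baire {p | δ.Names p x}

/-- The whole space is a computable overt set. -/
def ComputablyOvert (δ : Representation X) : Prop :=
  IsComputablePoint (overts δ) (hits δ Set.univ)

/-- There is a computable sequence that is dense: it meets every nonempty open set. -/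
def EffectivelySeparable (δ : Representation X) : Prop :=
  ∃ a : ℕ → X, IsComputable nat δ a ∧ ∀ U : Opens δ, (∃ x, U.1 x) → ∃ n, U.1 (a n)

end Hyperspaces

/-! ### Rounded ideals and quasi-Polish spaces -/

/-- Rounded ideals of a relation on `ℕ`. -/
def IsRoundedIdeal (r : ℕ → ℕ → Prop) (I : Set ℕ) : Prop :=
  I.Nonempty ∧ (∀ x y, y ∈ I → r x y → x ∈ I) ∧
    ∀ x y, x ∈ I → y ∈ I → ∃ z ∈ I, r x z ∧ r y z

/-- The space of rounded ideals of `r`, as a subspace of the space of all subsets of `ℕ`. -/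
def roundedIdeals (r : ℕ → ℕ → Prop) : Representation {I : Set ℕ // IsRoundedIdeal r I} :=
  enumNat.subspace (IsRoundedIdeal r)

/-- A computably enumerable binary relation on `ℕ`. -/
def IsCE₂ (r : ℕ → ℕ → Prop) : Prop := REPred fun a : ℕ × ℕ => r a.1 a.2

/-- The extendability predicate: `n` belongs to some rounded ideal. -/
def Extendable (r : ℕ → ℕ → Prop) (n : ℕ) : Prop := ∃ I, IsRoundedIdeal r I ∧ n ∈ I

/-- Precomputable quasi-Polish spaces: computably isomorphic to the space of rounded ideals of a
computably enumerable transitive relation. -/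
def PrecomputablyQuasiPolish {X : Type*} (δ : Representation X) : Prop :=
  ∃ r : ℕ → ℕ → Prop, (∀ a b c, r a b → r b c → r a c) ∧ IsCE₂ r ∧
    ComputablyIsomorphic δ (roundedIdeals r)

end RepSpace

/-! ### Primitive recursive and computably enumerable predicates -/

-- The implications are proved in the cycle (i) ⇒ (ii) ⇒ (iv) ⇒ (iii) ⇒ (i). The first two are
-- short. If a computable sequence is dense, an open set is non-empty exactly when it contains a
-- member of the sequence, and such a member can be searched for. If `X` is overt and identified
-- with `RI(≺)`, the set of ideals that contain `n` is open uniformly in `n`, and its non-emptiness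
-- is the extendability of `n` (`ComputablyOvert.rePred_extendable`).
--
-- For (iv) ⇒ (iii), a point is named by a `≺`-increasing sequence that generates its ideal. An
-- extendable number lies in a rounded ideal, hence has an extendable number above it; a letter that
-- does not certify its proposed next member is therefore read as a computable default successor.
-- Thus every point of Baire space codes a chain (`nonempty_chainCoding`), and the representation is
-- total. A non-empty word extends to a name of an ideal exactly when its last chain member lies in
-- that ideal (`ChainCoding.exists_ideal_eq`); this yields fiber-overtness. Admissibility holds
-- because the ideal can be read off the neighbourhood filter and then turned into a chain.
--
-- For (iii) ⇒ (i), a point is described by the words that extend to its names. Fiber-overtness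
-- makes this property of a word semi-decidable from a name of the point
-- (`EffectivelyFiberOvert.exists_isMeetRelation`). The relation `below` on finite lists of words is
-- designed so that the words occurring in a rounded ideal contain an infinite branch whose prefixes
-- confirm exactly these words. Totality makes the branch a name of some point, whose words are then
-- the given ones (`IsMeetRelation.exists_meetIdeal_eq`). These words determine the neighbourhood
-- filter, from which admissibility recovers the point (`IsMeetRelation.computablyIsomorphic`).
-- Totality also gives a dense computable sequence: the points named by eventually zero sequences.

attribute [fun_prop] Primrec
attribute [fun_prop] Computable
attribute [fun_prop] Primrec.id Primrec.const Primrec.comp Primrec.pair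
attribute [fun_prop] Computable.id Computable.const Computable.comp Computable.pair

namespace RepSpace

section Primitive

variable {α β γ : Type*} [Primcodable α] [Primcodable β] [Primcodable γ]

@[fun_prop] theorem primrec_fst {f : α → β × γ} (h : Primrec f) : Primrec fun a => (f a).1 :=
  Primrec.fst.comp h

@[fun_prop] theorem primrec_snd {f : α → β × γ} (h : Primrec f) : Primrec fun a => (f a).2 :=
  Primrec.snd.comp h

@[fun_prop] theorem primrec_take {f : α → ℕ} {g : α → List β} (hf : Primrec f) (hg : Primrec g) :
    Primrec fun a => (g a).take (f a) := Primrec.list_take.comp hf hg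

@[fun_prop] theorem primrec_length {g : α → List β} (hg : Primrec g) :
    Primrec fun a => (g a).length := Primrec.list_length.comp hg

@[fun_prop] theorem primrec_append {f g : α → List β} (hf : Primrec f) (hg : Primrec g) :
    Primrec fun a => f a ++ g a := Primrec.list_append.comp hf hg

@[fun_prop] theorem primrec_cons {f : α → β} {g : α → List β} (hf : Primrec f) (hg : Primrec g) :
    Primrec fun a => f a :: g a := Primrec.list_cons.comp hf hg

@[fun_prop] theorem primrec_add {f g : α → ℕ} (hf : Primrec f) (hg : Primrec g) :
    Primrec fun a => f a + g a := Primrec.nat_add.comp hf hg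

@[fun_prop] theorem primrec_sub {f g : α → ℕ} (hf : Primrec f) (hg : Primrec g) :
    Primrec fun a => f a - g a := Primrec.nat_sub.comp hf hg

@[fun_prop] theorem primrec_unpair {f : α → ℕ} (hf : Primrec f) :
    Primrec fun a => (f a).unpair := Primrec.unpair.comp hf

@[fun_prop] theorem primrec_range {f : α → ℕ} (hf : Primrec f) :
    Primrec fun a => List.range (f a) := Primrec.list_range.comp hf

@[fun_prop] theorem primrec_getD {f : α → ℕ} {g : α → List β} {d : β} (hf : Primrec f)
    (hg : Primrec g) : Primrec fun a => (g a).getD (f a) d := (Primrec.list_getD d).comp hg hf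

@[fun_prop] theorem primrec_ofNat_list {f : α → ℕ} (hf : Primrec f) :
    Primrec fun a => Denumerable.ofNat (List ℕ) (f a) := (Primrec.ofNat _).comp hf

@[fun_prop] theorem primrec_ofNat_list_list {f : α → ℕ} (hf : Primrec f) :
    Primrec fun a => Denumerable.ofNat (List (List ℕ)) (f a) := (Primrec.ofNat _).comp hf

@[fun_prop] theorem primrec_encode {f : α → β} (hf : Primrec f) :
    Primrec fun a => Encodable.encode (f a) := Primrec.encode.comp hf

@[fun_prop] theorem primrec_and {f g : α → Bool} (hf : Primrec f) (hg : Primrec g) :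
    Primrec fun a => f a && g a := Primrec.and.comp hf hg

@[fun_prop] theorem primrec_or {f g : α → Bool} (hf : Primrec f) (hg : Primrec g) :
    Primrec fun a => f a || g a := Primrec.or.comp hf hg

@[fun_prop] theorem primrec_not {f : α → Bool} (hf : Primrec f) :
    Primrec fun a => !f a := Primrec.not.comp hf

@[fun_prop] theorem primrec_bif {c : α → Bool} {f g : α → β} (hc : Primrec c) (hf : Primrec f)
    (hg : Primrec g) : Primrec fun a => bif c a then f a else g a := Primrec.cond hc hf hg

@[fun_prop] theorem primrec_some {f : α → β} (hf : Primrec f) : Primrec fun a => some (f a) :=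
  Primrec.option_some.comp hf

@[fun_prop] theorem primrec_isSome {f : α → Option β} (hf : Primrec f) :
    Primrec fun a => (f a).isSome := Primrec.option_isSome.comp hf

@[fun_prop] theorem primrec_decide_eq [DecidableEq β] {f g : α → β} (hf : Primrec f)
    (hg : Primrec g) : Primrec fun a => decide (f a = g a) := Primrec.eq.decide.comp hf hg

@[fun_prop] theorem primrec_decide_ne [DecidableEq β] {f g : α → β} (hf : Primrec f)
    (hg : Primrec g) : Primrec fun a => decide (f a ≠ g a) :=
  (primrec_not (primrec_decide_eq hf hg)).of_eq (by simp)

@[fun_prop] theorem primrec_decide_le {f g : α → ℕ} (hf : Primrec f) (hg : Primrec g) :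
    Primrec fun a => decide (f a ≤ g a) := Primrec.nat_le.decide.comp hf hg

@[fun_prop] theorem primrec_decide_lt {f g : α → ℕ} (hf : Primrec f) (hg : Primrec g) :
    Primrec fun a => decide (f a < g a) := Primrec.nat_lt.decide.comp hf hg

theorem primrec_any {g : α → List β} {f : α → β → Bool} (hg : Primrec g)
    (hf : Primrec fun x : α × β => f x.1 x.2) : Primrec fun a => (g a).any (f a) :=
  (Primrec.list_foldr hg (Primrec.const false) (h := fun a x => f a x.1 || x.2)
    (Primrec.or.comp (hf.comp (Primrec.fst.pair (Primrec.fst.comp Primrec.snd)))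
      (Primrec.snd.comp Primrec.snd))).of_eq fun a => by induction g a <;> simp [*]

theorem primrec_all {g : α → List β} {f : α → β → Bool} (hg : Primrec g)
    (hf : Primrec fun x : α × β => f x.1 x.2) : Primrec fun a => (g a).all (f a) :=
  (primrec_not (primrec_any (f := fun a b => !f a b) hg (by fun_prop))).of_eq
    fun a => by induction g a <;> simp_all

theorem primrec_map {g : α → List β} {f : α → β → γ} (hg : Primrec g)
    (hf : Primrec fun x : α × β => f x.1 x.2) : Primrec fun a => (g a).map (f a) :=
  Primrec.list_map hg hf

@[fun_prop] theorem primrec_decide_mem {f : α → β} {g : α → List β}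
    [∀ a, Decidable (f a ∈ g a)] (hf : Primrec f) (hg : Primrec g) :
    Primrec fun a => decide (f a ∈ g a) := by
  classical
  refine (primrec_any (f := fun a b => decide (b = f a)) hg (by fun_prop)).of_eq fun a => ?_
  rw [Bool.eq_iff_iff]
  simp

@[fun_prop] theorem primrec_decide_prefix {f g : α → List ℕ} (hf : Primrec f) (hg : Primrec g) :
    Primrec fun a => decide (f a <+: g a) :=
  (primrec_decide_eq (f := fun a => (g a).take (f a).length) (g := f) (by fun_prop) hf).of_eq
    fun a => by simp [List.prefix_iff_eq_take, eq_comm]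

@[fun_prop] theorem computable_fst {f : α → β × γ} (h : Computable f) :
    Computable fun a => (f a).1 := Computable.fst.comp h

@[fun_prop] theorem computable_snd {f : α → β × γ} (h : Computable f) :
    Computable fun a => (f a).2 := Computable.snd.comp h

@[fun_prop] theorem computable_take {f : α → ℕ} {g : α → List β} (hf : Computable f)
    (hg : Computable g) : Computable fun a => (g a).take (f a) :=
  Primrec.list_take.to_comp.comp hf hg

end Primitive

/-! ### Closure properties of computably enumerable predicates, and search. -/

section Enumerable

variable {α β : Type*} [Primcodable α] [Primcodable β]

/-- The stage approximations of a computably enumerable predicate. -/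
theorem exists_primrec_of_rePred {P : α → Prop} (h : REPred P) :
    ∃ f : α × ℕ → Bool, Primrec f ∧ ∀ a, P a ↔ ∃ n, f (a, n) = true := by
  obtain ⟨c, hc⟩ := Nat.Partrec.Code.exists_code.1 h
  refine ⟨fun x => (Nat.Partrec.Code.evaln x.2 c (Encodable.encode x.1)).isSome, ?_, fun a => ?_⟩
  · refine primrec_isSome (Nat.Partrec.Code.primrec_evaln.comp
      (f := fun a : (ℕ × Nat.Partrec.Code) × ℕ => Nat.Partrec.Code.evaln a.1.1 a.1.2 a.2)
      (g := fun x : α × ℕ => ((x.2, c), Encodable.encode x.1)) ?_)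
    fun_prop
  · have key : ((Nat.Partrec.Code.eval c (Encodable.encode a)).Dom ↔ P a) := by
      rw [hc]
      simp [Part.assert]
    rw [← key, Part.dom_iff_mem]
    simp only [Nat.Partrec.Code.evaln_complete, Option.isSome_iff_exists, Option.mem_def]
    exact exists_comm

theorem rePred_of_stages {P : α → Prop} {f : α × ℕ → Bool} (hf : Computable f)
    (h : ∀ a, P a ↔ ∃ n, f (a, n) = true) : REPred P := by
  have : Partrec fun a => Nat.rfind fun n => Part.some (f (a, n)) :=
    Partrec.rfind (Computable.partrec hf)
  refine this.dom_re.of_eq fun a =>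
    ((h a).trans ⟨fun ⟨n, hn⟩ => Nat.rfind_dom.2 ⟨n, by simpa using hn.symm, fun _ => trivial⟩,
      fun H => ?_⟩).symm
  obtain ⟨n, hn, -⟩ := Nat.rfind_dom.1 H
  exact ⟨n, by simpa using hn⟩

theorem rePred_of_bool {f : α → Bool} (hf : Computable f) : REPred fun a => f a = true :=
  rePred_of_stages (f := fun x => f x.1) (by fun_prop) (by simp)

theorem _root_.REPred.comp {P : β → Prop} (h : REPred P) {g : α → β} (hg : Computable g) :
    REPred fun a => P (g a) := by
  obtain ⟨f, hf, hP⟩ := exists_primrec_of_rePred h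
  have := hf.to_comp
  exact rePred_of_stages (f := fun x => f (g x.1, x.2)) (by fun_prop) fun a => hP _

theorem _root_.REPred.and {P Q : α → Prop} (hP : REPred P) (hQ : REPred Q) :
    REPred fun a => P a ∧ Q a := by
  obtain ⟨f, hf, hP⟩ := exists_primrec_of_rePred hP
  obtain ⟨g, hg, hQ⟩ := exists_primrec_of_rePred hQ
  refine rePred_of_stages (f := fun x => f (x.1, x.2.unpair.1) && g (x.1, x.2.unpair.2))
    (Primrec.to_comp (by fun_prop)) fun a => ?_
  rw [hP, hQ]
  constructor
  · rintro ⟨⟨m, hm⟩, n, hn⟩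
    exact ⟨Nat.pair m n, by simp [hm, hn]⟩
  · rintro ⟨n, hn⟩
    rw [Bool.and_eq_true] at hn
    exact ⟨⟨_, hn.1⟩, _, hn.2⟩

theorem _root_.REPred.or {P Q : α → Prop} (hP : REPred P) (hQ : REPred Q) :
    REPred fun a => P a ∨ Q a := by
  obtain ⟨f, hf, hP⟩ := exists_primrec_of_rePred hP
  obtain ⟨g, hg, hQ⟩ := exists_primrec_of_rePred hQ
  refine rePred_of_stages (f := fun x => f x || g x) (Primrec.to_comp (by fun_prop)) fun a => ?_
  simp only [hP, hQ, Bool.or_eq_true, exists_or]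

theorem _root_.REPred.exists_nat {P : α × ℕ → Prop} (hP : REPred P) :
    REPred fun a => ∃ n, P (a, n) := by
  obtain ⟨f, hf, hP⟩ := exists_primrec_of_rePred hP
  refine rePred_of_stages (f := fun x => f ((x.1, x.2.unpair.1), x.2.unpair.2))
    (Primrec.to_comp (by fun_prop)) fun a => ?_
  simp only [hP]
  constructor
  · rintro ⟨m, n, hn⟩
    exact ⟨Nat.pair m n, by simpa using hn⟩
  · rintro ⟨n, hn⟩
    exact ⟨_, _, hn⟩

theorem _root_.REPred.exists_list {P : α × List ℕ → Prop} (hP : REPred P) :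
    REPred fun a => ∃ w, P (a, w) := by
  have h : REPred fun x : α × ℕ => P (x.1, Denumerable.ofNat (List ℕ) x.2) :=
    hP.comp (g := fun x : α × ℕ => (x.1, Denumerable.ofNat (List ℕ) x.2))
      (Primrec.to_comp (by fun_prop))
  refine h.exists_nat.of_eq fun a => ⟨fun ⟨n, hn⟩ => ⟨_, hn⟩, fun ⟨w, hw⟩ => ?_⟩
  exact ⟨Encodable.encode w, by simpa using hw⟩

/-- A nonempty computably enumerable set is the range of a computable sequence. -/
theorem exists_computable_range {P : ℕ → Prop} (hP : REPred P) (hne : ∃ n, P n) :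
    ∃ e : ℕ → ℕ, Computable e ∧ ∀ n, P n ↔ ∃ i, e i = n := by
  obtain ⟨f, hf, hP⟩ := exists_primrec_of_rePred hP
  obtain ⟨n₀, hn₀⟩ := hne
  refine ⟨fun i => bif f i.unpair then i.unpair.1 else n₀, Primrec.to_comp (by fun_prop),
    fun n => ⟨fun hn => ?_, ?_⟩⟩
  · obtain ⟨s, hs⟩ := (hP n).1 hn
    exact ⟨Nat.pair n s, by simp [hs]⟩
  · rintro ⟨i, rfl⟩
    dsimp only
    cases h : f i.unpair
    · exact hn₀
    · exact (hP _).2 ⟨_, h⟩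

/-- Unbounded search. -/
theorem exists_computable_choice {f : α × ℕ → Bool} (hf : Computable f)
    (h : ∀ a, ∃ n, f (a, n) = true) : ∃ g : α → ℕ, Computable g ∧ ∀ a, f (a, g a) = true := by
  refine ⟨fun a => Nat.find (h a), Computable.find (P := fun a n => f (a, n) = true) ?_ h,
    fun a => Nat.find_spec (h a)⟩
  exact ComputablePred.computable_iff.2 ⟨f, hf, rfl⟩

/-- A computably enumerable predicate of words, regarded as a predicate of infinite sequences, has
a decidable approximation that is preserved by extensions of the word. -/
theorem exists_monotone_of_rePred {P : α × List ℕ → Prop} (hP : REPred P) :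
    ∃ R : α × List ℕ → Bool, Primrec R ∧
      (∀ a v v', v <+: v' → R (a, v) = true → R (a, v') = true) ∧
      ∀ a p, (∃ k, R (a, pre p k) = true) ↔ ∃ k, P (a, pre p k) := by
  obtain ⟨f, hf, hP⟩ := exists_primrec_of_rePred hP
  -- The index `t` pairs a prefix length with a stage. As `t` is at most the length of the word, the
  -- truncation is unaffected when the word is extended, which gives monotonicity.
  refine ⟨fun x => (List.range (x.2.length + 1)).any fun t =>
    f ((x.1, x.2.take t.unpair.1), t.unpair.2), primrec_any (by fun_prop) (by fun_prop), ?_, ?_⟩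
  · rintro a v _ ⟨u, rfl⟩ h
    simp only [List.any_eq_true, List.mem_range, List.length_append] at h ⊢
    obtain ⟨t, ht, h⟩ := h
    refine ⟨t, by omega, ?_⟩
    have := Nat.unpair_left_le t
    rwa [List.take_append_of_le_length (by omega)]
  · intro a p
    simp only [List.any_eq_true, List.mem_range, length_pre, hP]
    constructor
    · rintro ⟨k, t, ht, h⟩
      have := Nat.unpair_left_le t
      rw [take_pre (by omega)] at h
      exact ⟨_, _, h⟩
    · rintro ⟨k, s, h⟩
      refine ⟨Nat.pair k s, Nat.pair k s, by omega, ?_⟩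
      rw [Nat.unpair_pair, take_pre (Nat.left_le_pair _ _)]
      exact h

end Enumerable

/-! ### Prefixes and limits of increasing sequences of words -/

theorem pre_succ (p : ℕ → ℕ) (n : ℕ) : pre p (n + 1) = pre p n ++ [p n] := by
  simp [pre, List.range_succ]

theorem pre_prefix_pre (p : ℕ → ℕ) {m n : ℕ} (h : m ≤ n) : pre p m <+: pre p n := by
  rw [← take_pre h]
  exact List.take_prefix _ _

theorem eq_pre_of_prefix {w : List ℕ} {p : ℕ → ℕ} {n : ℕ} (h : w <+: pre p n) :
    w = pre p w.length := by
  have hl := h.length_le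
  rw [length_pre] at hl
  rw [← take_pre hl]
  exact List.prefix_iff_eq_take.1 h

theorem pre_eq_iff {p q : ℕ → ℕ} {n : ℕ} : pre p n = pre q n ↔ ∀ i < n, p i = q i := by
  simp [pre]

/-- The infinite sequence that extends `w` by zeros. -/
def extendZero (w : List ℕ) (n : ℕ) : ℕ := w.getD n 0

theorem pre_extendZero (w : List ℕ) : pre (extendZero w) w.length = w := by
  apply List.ext_getElem (length_pre _ _) fun i h h' => ?_
  simp [pre, extendZero, h']

theorem exists_limit_word (s : ℕ → List ℕ) (mono : ∀ k, s k <+: s (k + 1))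
    (unb : ∀ n, ∃ k, n ≤ (s k).length) : ∃ q, ∀ k, s k = pre q (s k).length := by
  have hm : ∀ k l, k ≤ l → s k <+: s l := by
    intro k l h
    induction l, h using Nat.le_induction with
    | base => exact List.prefix_refl _
    | succ l _ ih => exact ih.trans (mono l)
  choose K hK using fun n => unb (n + 1)
  refine ⟨fun n => (s (K n)).getD n 0, fun k => ?_⟩
  apply List.ext_getElem (length_pre _ _).symm fun i h h' => ?_
  have hi : i < (s (K i)).length := hK i
  simp only [pre, List.getElem_map, List.getElem_range, List.getD_eq_getElem?_getD,
    List.getElem?_eq_getElem hi, Option.getD_some]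
  rcases le_total k (K i) with hk | hk
  · exact (hm _ _ hk).getElem h
  · exact ((hm _ _ hk).getElem hi).symm

/-! ### Construction of word functions -/

/-- The word function that, reading one letter after the other, appends the letter `t.unpair.1` to
the output `u` for the least suitable candidate `t` that has appeared. -/
def greedy (good : (List ℕ × List ℕ) × ℕ → Bool) (w : List ℕ) : List ℕ :=
  (List.range w.length).foldl (fun u k => u ++ ((List.range (k + 1)).filterMap fun t =>
    bif good ((w.take k, u), t) then some t.unpair.1 else none).take 1) []

theorem primrec_greedy {good : (List ℕ × List ℕ) × ℕ → Bool} (h : Primrec good) :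
    Primrec (greedy good) := by
  refine Primrec.list_foldl (h := fun (w : List ℕ) (x : List ℕ × ℕ) => x.1 ++
    ((List.range (x.2 + 1)).filterMap fun t =>
      bif good ((w.take x.2, x.1), t) then some t.unpair.1 else none).take 1)
    (by fun_prop) (by fun_prop) ?_
  have : Primrec fun y : List ℕ × (List ℕ × ℕ) => (List.range (y.2.2 + 1)).filterMap fun t =>
      bif good ((y.1.take y.2.2, y.2.1), t) then some t.unpair.1 else none := by
    refine Primrec.listFilterMap (by fun_prop) ?_
    unfold Primrec₂
    fun_prop
  unfold Primrec₂
  fun_prop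

/-- The output can never get stuck: from some point on, a suitable candidate for the current output
is both permanently acceptable and within the search bound, so some letter is appended. The
invariant holds because only accepted letters are appended. -/
theorem exists_yields_greedy {good : (List ℕ × List ℕ) × ℕ → Bool} {p : ℕ → ℕ}
    {Inv : List ℕ → Prop} (h₀ : Inv [])
    (hex : ∀ u, Inv u → ∃ t k₀, ∀ k ≥ k₀, good ((pre p k, u), t) = true)
    (hstep : ∀ u k t, Inv u → good ((pre p k, u), t) = true → Inv (u ++ [t.unpair.1])) :
    ∃ q, Yields (greedy good) p q ∧ ∀ n, Inv (pre q n) := by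
  let ext (k : ℕ) (u : List ℕ) : List ℕ := ((List.range (k + 1)).filterMap fun t =>
    bif good ((pre p k, u), t) then some t.unpair.1 else none).take 1
  let s (k : ℕ) : List ℕ := greedy good (pre p k)
  have s_eq : ∀ k, s k = (List.range k).foldl (fun u k => u ++ ext k u) [] := by
    intro k
    simp only [s, greedy, length_pre, ext]
    apply List.foldl_ext
    intro u j hj
    rw [take_pre (List.mem_range.1 hj).le]
  have s_zero : s 0 = [] := by simp [s_eq]
  have s_succ : ∀ k, s (k + 1) = s k ++ ext k (s k) := by
    intro k
    simp only [s_eq, List.range_succ, List.foldl_append, List.foldl_cons, List.foldl_nil]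
  have ext_cases : ∀ k u, ext k u = [] ∨ ∃ t, good ((pre p k, u), t) = true ∧
      ext k u = [t.unpair.1] := by
    intro k u
    rcases h : (List.range (k + 1)).filterMap fun t =>
      bif good ((pre p k, u), t) then some t.unpair.1 else none with _ | ⟨a, l⟩
    · left
      simp only [ext, h, List.take_nil]
    · right
      have ha : a ∈ (List.range (k + 1)).filterMap fun t =>
        bif good ((pre p k, u), t) then some t.unpair.1 else none := by simp [h]
      obtain ⟨t, -, ht⟩ := List.mem_filterMap.1 ha
      cases hg : good ((pre p k, u), t)
      · simp [hg] at ht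
      · refine ⟨t, hg, ?_⟩
        simp only [hg, cond_true, Option.some.injEq] at ht
        simp only [ext, h, ht]
        simp
  have inv : ∀ k, ∀ v, v <+: s k → Inv v := by
    intro k
    induction k with
    | zero =>
      intro v hv
      rw [s_zero, List.prefix_nil] at hv
      rwa [hv]
    | succ k ih =>
      intro v hv
      rw [s_succ] at hv
      rcases ext_cases k (s k) with h | ⟨t, ht, h⟩
      · rw [h, List.append_nil] at hv
        exact ih v hv
      · rw [h, List.prefix_concat_iff] at hv
        rcases hv with rfl | hv
        · exact hstep _ _ _ (ih _ (List.prefix_refl _)) ht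
        · exact ih v hv
  have unb : ∀ n, ∃ k, n ≤ (s k).length := by
    intro n
    induction n with
    | zero => exact ⟨0, Nat.zero_le _⟩
    | succ n ih =>
      obtain ⟨k, hk⟩ := ih
      -- Otherwise the output keeps its length from `k` on; the candidate `t` for this frozen output
      -- then forces one more letter.
      by_contra! hcon
      have hlen : ∀ l, k ≤ l → s l = s k := by
        intro l hl
        induction l, hl using Nat.le_induction with
        | base => rfl
        | succ l hl ih =>
          have h1 := hcon (l + 1)
          rw [s_succ, List.length_append, ih] at h1
          have h2 : (ext l (s k)).length = 0 := by omega
          rw [s_succ, ih, List.length_eq_zero_iff.1 h2, List.append_nil]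
      obtain ⟨t, k₀, ht⟩ := hex (s k) (inv k _ (List.prefix_refl _))
      have h1 := hcon (max k (max k₀ t) + 1)
      rw [s_succ, hlen _ (le_max_left _ _), List.length_append] at h1
      have h2 : (ext (max k (max k₀ t)) (s k)).length = 0 := by omega
      have h3 := List.length_eq_zero_iff.1 h2
      have hmem : t.unpair.1 ∈ (List.range (max k (max k₀ t) + 1)).filterMap fun x =>
          bif good ((pre p (max k (max k₀ t)), s k), x) then some x.unpair.1 else none := by
        have := ht (max k (max k₀ t)) (by omega)
        exact List.mem_filterMap.2 ⟨t, by simp, by simp [this]⟩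
      simp only [ext, List.take_eq_nil_iff, one_ne_zero, false_or] at h3
      rw [h3] at hmem
      exact List.not_mem_nil hmem
  obtain ⟨q, hq⟩ := exists_limit_word s
    (fun k => by rw [s_succ]; exact List.prefix_append _ _) unb
  refine ⟨q, ⟨hq, unb⟩, fun n => ?_⟩
  obtain ⟨k, hk⟩ := unb n
  exact inv k _ (by rw [hq k]; exact pre_prefix_pre q hk)

/-- Output words can be extended one letter at a time by a search for letters that are enumerated
relative to the argument. -/
theorem exists_computable_extension {G : (List ℕ × List ℕ) × ℕ → Prop} (hG : REPred G) :
    ∃ h, Computable h ∧ ∀ (p : ℕ → ℕ) (Inv : List ℕ → Prop), Inv [] →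
      (∀ u, Inv u → ∃ a k, G ((pre p k, u), a)) →
      (∀ u k a, Inv u → G ((pre p k, u), a) → Inv (u ++ [a])) →
      ∃ q, Yields h p q ∧ ∀ n, Inv (pre q n) := by
  obtain ⟨f, hf, hP⟩ := exists_primrec_of_rePred hG
  -- A candidate packs the letter, the prefix length at which it is justified and the stage
  -- confirming this, so that it stays acceptable as more of the argument is read.
  let good : (List ℕ × List ℕ) × ℕ → Bool := fun x =>
    decide (x.2.unpair.2.unpair.1 ≤ x.1.1.length) &&
      f (((x.1.1.take x.2.unpair.2.unpair.1, x.1.2), x.2.unpair.1), x.2.unpair.2.unpair.2)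
  have hgood : Primrec good := by fun_prop
  refine ⟨greedy good, (primrec_greedy hgood).to_comp, fun p Inv h₀ hex hstep => ?_⟩
  refine exists_yields_greedy h₀ (fun u hu => ?_) fun u k t hu ht => ?_
  · obtain ⟨a, k, hk⟩ := hex u hu
    obtain ⟨s, hs⟩ := (hP _).1 hk
    refine ⟨Nat.pair a (Nat.pair k s), k, fun k' hk' => ?_⟩
    simp only [good, Nat.unpair_pair, length_pre, take_pre hk', hs, Bool.and_true]
    simpa using hk'
  · simp only [good, Bool.and_eq_true, decide_eq_true_eq, length_pre] at ht
    rw [take_pre ht.1] at ht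
    exact hstep u _ _ hu ((hP _).2 ⟨_, ht.2⟩)

/-- A partial function whose graph is enumerable relative to the argument is computable. -/
theorem exists_computable_of_graph {P : List ℕ × (ℕ × ℕ) → Prop} (hP : REPred P) :
    ∃ h, Computable h ∧
      ∀ p q, (∀ n a, q n = a ↔ ∃ k, P (pre p k, n, a)) → Yields h p q := by
  obtain ⟨h, hh, H⟩ := exists_computable_extension (hP.comp
    (g := fun x : (List ℕ × List ℕ) × ℕ => (x.1.1, x.1.2.length, x.2))
    (Primrec.to_comp (by fun_prop)))
  refine ⟨h, hh, fun p q hpq => ?_⟩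
  obtain ⟨q', hq', hInv⟩ := H p (fun u => u = pre q u.length) (by simp [pre])
    (fun u _ => ⟨_, (hpq u.length _).1 rfl⟩) fun u k a hu ha => by
      rw [List.length_append, List.length_singleton, pre_succ, (hpq _ _).2 ⟨k, ha⟩, ← hu]
  have : q' = q := by
    funext n
    have := hInv (n + 1)
    rw [length_pre, pre_eq_iff] at this
    exact this n (Nat.lt_succ_self n)
  exact this ▸ hq'

/-! ### Reading off results of word functions; composition of computable maps. -/

theorem yields_getElem? {h : List ℕ → List ℕ} {p q : ℕ → ℕ} (H : Yields h p q) {n a : ℕ} :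
    q n = a ↔ ∃ k, (h (pre p k))[n]? = some a := by
  constructor
  · rintro rfl
    obtain ⟨k, hk⟩ := H.2 (n + 1)
    refine ⟨k, ?_⟩
    rw [H.1 k]
    exact getElem?_pre hk
  · rintro ⟨k, hk⟩
    have hn := (List.getElem?_eq_some_iff.1 hk).1
    rw [H.1 k, getElem?_pre hn] at hk
    exact Option.some.inj hk

theorem yields_prefix {h : List ℕ → List ℕ} {p q : ℕ → ℕ} (H : Yields h p q) {w : List ℕ} :
    (∃ n, w = pre q n) ↔ ∃ k, w <+: h (pre p k) := by
  constructor
  · rintro ⟨n, rfl⟩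
    obtain ⟨k, hk⟩ := H.2 n
    refine ⟨k, ?_⟩
    rw [H.1 k]
    exact pre_prefix_pre q hk
  · rintro ⟨k, hk⟩
    rw [H.1 k] at hk
    exact ⟨_, eq_pre_of_prefix hk⟩

/-- Computable partial functions on Baire space are closed under composition. -/
theorem exists_computable_comp {h g : List ℕ → List ℕ} (hh : Computable h) (hg : Computable g) :
    ∃ f, Computable f ∧ ∀ p q r, Yields h p q → Yields g q r → Yields f p r := by
  -- The output of `h` has to be truncated at every length: word functions need not be monotone, and
  -- the informative values of `g` may occur at prefix lengths that the outputs of `h` skip.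
  have hP : REPred fun x : List ℕ × (ℕ × ℕ) =>
      ∃ m, decide ((g ((h x.1).take m))[x.2.1]? = some x.2.2) = true := by
    refine (rePred_of_bool (f := fun y : (List ℕ × (ℕ × ℕ)) × ℕ =>
      decide ((g ((h y.1.1).take y.2))[y.1.2.1]? = some y.1.2.2)) ?_).exists_nat
    have h1 : Computable fun y : (List ℕ × (ℕ × ℕ)) × ℕ => (g ((h y.1.1).take y.2))[y.1.2.1]? :=
      Computable.list_getElem?.comp (by fun_prop) (by fun_prop)
    exact Primrec.eq.decide.to_comp.comp h1 (Computable.option_some.comp (by fun_prop))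
  obtain ⟨f, hf, H⟩ := exists_computable_of_graph hP
  refine ⟨f, hf, fun p q r hpq hqr => H p r fun n a => ?_⟩
  rw [yields_getElem? hqr]
  simp only [decide_eq_true_eq]
  constructor
  · rintro ⟨m, hm⟩
    obtain ⟨k, hk⟩ := (yields_prefix hpq).1 ⟨m, rfl⟩
    refine ⟨k, m, ?_⟩
    rw [List.prefix_iff_eq_take, length_pre] at hk
    rwa [← hk]
  · rintro ⟨k, m, hm⟩
    obtain ⟨n, hn⟩ := (yields_prefix hpq).2 ⟨k, List.take_prefix m _⟩
    exact ⟨n, hn ▸ hm⟩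

theorem IsComputableMulti.comp_left {X Y Z : Type*} {δX : Representation X}
    {δY : Representation Y} {δZ : Representation Z} {f : X → Y} {g : Y → Set Z}
    (hf : IsComputable δX δY f) (hg : IsComputableMulti δY δZ g) :
    IsComputableMulti δX δZ fun x => g (f x) := by
  obtain ⟨h, hh, Hh⟩ := hf
  obtain ⟨k, hk, Hk⟩ := hg
  obtain ⟨c, hc, Hc⟩ := exists_computable_comp hh hk
  refine ⟨c, hc, fun p x hp hne => ?_⟩
  obtain ⟨q, hq, _, rfl, hqy⟩ := Hh p x hp ⟨_, rfl⟩
  obtain ⟨r, hr, z, hz, hrz⟩ := Hk q _ hqy hne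
  exact ⟨r, Hc _ _ _ hq hr, z, hz, hrz⟩

theorem IsComputableMulti.comp_right {X Y Z : Type*} {δX : Representation X}
    {δY : Representation Y} {δZ : Representation Z} {f : X → Set Y} {g : Y → Z}
    (hf : IsComputableMulti δX δY f) (hg : IsComputable δY δZ g) :
    IsComputableMulti δX δZ fun x => g '' f x := by
  obtain ⟨h, hh, Hh⟩ := hf
  obtain ⟨k, hk, Hk⟩ := hg
  obtain ⟨c, hc, Hc⟩ := exists_computable_comp hh hk
  refine ⟨c, hc, fun p x hp hne => ?_⟩
  obtain ⟨q, hq, y, hy, hqy⟩ := Hh p x hp hne.of_image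
  obtain ⟨r, hr, _, rfl, hrz⟩ := Hk q y hqy ⟨_, rfl⟩
  exact ⟨r, Hc _ _ _ hq hr, _, ⟨y, hy, rfl⟩, hrz⟩

theorem IsComputable.comp {X Y Z : Type*} {δX : Representation X} {δY : Representation Y}
    {δZ : Representation Z} {g : Y → Z} {f : X → Y} (hg : IsComputable δY δZ g)
    (hf : IsComputable δX δY f) : IsComputable δX δZ fun x => g (f x) :=
  IsComputableMulti.comp_left (g := fun y => {g y}) hf hg

/-! ### Evaluation and computation of open sets -/

section

variable {X Y : Type*}

/-- The word function coded by a point with prefix `v` is seen to output a nonzero letter on the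
input `w`. -/
def hit (v w : List ℕ) : Bool :=
  (Denumerable.ofNat (List ℕ) (v.getD (Encodable.encode w) 0)).any fun m => decide (m ≠ 0)

@[fun_prop] theorem primrec_hit {α : Type*} [Primcodable α] {f g : α → List ℕ} (hf : Primrec f)
    (hg : Primrec g) : Primrec fun a => hit (f a) (g a) := by
  unfold hit
  exact primrec_any (by fun_prop) (by fun_prop)

@[fun_prop] theorem computable_hit {α : Type*} [Primcodable α] {f g : α → List ℕ}
    (hf : Computable f) (hg : Computable g) : Computable fun a => hit (f a) (g a) :=
  (primrec_hit (f := Prod.fst) (g := Prod.snd) Primrec.fst Primrec.snd).to_comp.comp (hf.pair hg)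

theorem exists_hit_iff {u : ℕ → ℕ} {w : List ℕ} :
    (∃ k, hit (pre u k) w = true) ↔ ∃ m ∈ wordFun u w, m ≠ 0 := by
  simp only [hit, List.any_eq_true, decide_eq_true_eq, wordFun]
  constructor
  · rintro ⟨k, m, hm, h⟩
    refine ⟨m, ?_, h⟩
    by_cases hk : Encodable.encode w < k
    · rwa [List.getD_eq_getElem?_getD, getElem?_pre hk] at hm
    · rw [List.getD_eq_default _ _ (by simpa [length_pre] using hk)] at hm
      -- The default value `0` codes the empty word, so a position not yet read never counts as a
      -- hit.
      have : Denumerable.ofNat (List ℕ) 0 = [] := Denumerable.ofNat_encode ([] : List ℕ)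
      simp [this] at hm
  · rintro ⟨m, hm, h⟩
    refine ⟨Encodable.encode w + 1, m, ?_, h⟩
    rwa [List.getD_eq_getElem?_getD, getElem?_pre (Nat.lt_succ_self _)]

theorem Realizes.open_iff {δ : Representation X} {h : List ℕ → List ℕ} {S : X → Prop}
    (H : Realizes δ sierpinski h fun x => {S x}) {p : ℕ → ℕ} {x : X} (hp : δ.Names p x) :
    S x ↔ ∃ k, ∃ m ∈ h (pre p k), m ≠ 0 := by
  obtain ⟨r, hr, y, rfl, hry⟩ := H p x hp ⟨_, rfl⟩
  refine Iff.trans hry ⟨?_, ?_⟩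
  · rintro ⟨n, hn⟩
    obtain ⟨k, hk⟩ := hr.2 (n + 1)
    refine ⟨k, r n, ?_, hn⟩
    rw [hr.1 k]
    exact List.mem_of_getElem? (getElem?_pre hk)
  · rintro ⟨k, m, hm, hm0⟩
    rw [hr.1 k] at hm
    obtain ⟨i, -, rfl⟩ := List.mem_map.1 hm
    exact ⟨i, hm0⟩

theorem Opens.names_iff {δ : Representation X} {U : Opens δ} {u p : ℕ → ℕ} {x : X}
    (hu : (opens δ).Names u U) (hp : δ.Names p x) :
    U.1 x ↔ ∃ k l, hit (pre u k) (pre p l) = true := by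
  exact (Realizes.open_iff hu hp).trans
    ((exists_congr fun l => exists_hit_iff.symm).trans exists_comm)

/-- The word function that applies `b` to all proper prefixes of its argument. -/
def monitor (b : List ℕ → ℕ) (w : List ℕ) : List ℕ :=
  (List.range w.length).map fun i => b (w.take i)

theorem primrec_monitor {β : Type*} [Primcodable β] {b : β → List ℕ → ℕ}
    (hb : Primrec fun x : β × List ℕ => b x.1 x.2) :
    Primrec fun x : β × List ℕ => monitor (b x.1) x.2 :=
  primrec_map (f := fun (x : β × List ℕ) i => b x.1 (x.2.take i)) (by fun_prop)
    (hb.comp (g := fun y : (β × List ℕ) × ℕ => (y.1.1, y.1.2.take y.2)) (by fun_prop))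

theorem monitor_pre (b : List ℕ → ℕ) (p : ℕ → ℕ) (k : ℕ) :
    monitor b (pre p k) = pre (fun i => b (pre p i)) k := by
  simp only [monitor, length_pre]
  change _ = (List.range k).map fun i => b (pre p i)
  refine List.map_congr_left fun i hi => ?_
  rw [take_pre (List.mem_range.1 hi).le]

theorem yields_of_eq_pre {h : List ℕ → List ℕ} {p q : ℕ → ℕ} (H : ∀ k, h (pre p k) = pre q k) :
    Yields h p q :=
  ⟨fun k => by rw [H, length_pre], fun n => ⟨n, by rw [H, length_pre]⟩⟩

/-- An enumeration relative to the argument can be computed. -/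
theorem exists_computable_enum {P : ℕ × List ℕ → Prop} (hP : REPred P) :
    ∃ h, Computable h ∧ ∀ p A, (∀ n, n ∈ A ↔ ∃ k, P (n, pre p k)) →
      ∃ q, Yields h p q ∧ enumNat.Names q A := by
  obtain ⟨f, hf, hP⟩ := exists_primrec_of_rePred hP
  -- The output position codes a number, a prefix length and a stage. The prefix length is at most
  -- the position, so enough of the argument has been read.
  let b : List ℕ → ℕ := fun w =>
    bif f ((w.length.unpair.1, w.take w.length.unpair.2.unpair.1), w.length.unpair.2.unpair.2)
      then w.length.unpair.1 + 1 else 0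
  have hb : Primrec fun x : Unit × List ℕ => b x.2 := by fun_prop
  refine ⟨monitor b, ((primrec_monitor (b := fun _ => b) hb).comp
    (g := fun w => ((), w)) (by fun_prop)).to_comp,
    fun p A hA => ⟨_, yields_of_eq_pre (monitor_pre b p), fun n => ?_⟩⟩
  simp only [hA, hP, b, length_pre]
  have htake : ∀ i, (pre p i).take i.unpair.2.unpair.1 = pre p i.unpair.2.unpair.1 := fun i =>
    take_pre ((Nat.unpair_left_le _).trans (Nat.unpair_right_le _))
  simp only [htake]
  constructor
  · rintro ⟨k, s, hs⟩
    exact ⟨Nat.pair n (Nat.pair k s), by simp [hs]⟩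
  · rintro ⟨i, hi⟩
    cases h : f ((i.unpair.1, pre p i.unpair.2.unpair.1), i.unpair.2.unpair.2)
    · rw [h] at hi
      simp at hi
    · rw [h] at hi
      obtain rfl : i.unpair.1 = n := by simpa using hi
      exact ⟨_, _, h⟩

/-- A uniformly enumerable family of open sets has uniformly computable names. -/
theorem exists_primrec_names {β : Type*} [Primcodable β] {P : β × List ℕ → Prop} (hP : REPred P) :
    ∃ u : β → ℕ → ℕ, Primrec (fun x : β × ℕ => u x.1 x.2) ∧
      ∀ (b : β) (δ : Representation X) (S : X → Prop),
        (∀ p x, δ.Names p x → (S x ↔ ∃ k, P (b, pre p k))) →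
        Realizes δ sierpinski (wordFun (u b)) fun x => {S x} := by
  obtain ⟨R, hR, -, hRP⟩ := exists_monotone_of_rePred hP
  refine ⟨fun b n => Encodable.encode
    (monitor (fun w => bif R (b, w) then 1 else 0) (Denumerable.ofNat (List ℕ) n)), ?_, ?_⟩
  · have := primrec_monitor (b := fun (b : β) w => bif R (b, w) then 1 else 0) (by fun_prop)
    exact Primrec.encode.comp (this.comp (g := fun x : β × ℕ =>
      (x.1, Denumerable.ofNat (List ℕ) x.2)) (by fun_prop))
  · intro b δ S hS p x hp _
    refine ⟨fun i => bif R (b, pre p i) then 1 else 0, yields_of_eq_pre fun k => ?_, _, rfl, ?_⟩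
    · simp only [wordFun, Denumerable.ofNat_encode]
      exact monitor_pre _ _ _
    · refine (hS p x hp).trans ((hRP b p).symm.trans (exists_congr fun k => ?_))
      cases h : R (b, pre p k) <;> simp [h]

/-- Currying for maps into spaces of open sets. -/
theorem exists_computable_curry {P : List ℕ × List ℕ → Prop} (hP : REPred P) :
    ∃ h, Computable h ∧ ∀ p, ∃ q, Yields h p q ∧ ∀ (δ : Representation X) (S : X → Prop),
      (∀ u x, δ.Names u x → (S x ↔ ∃ k l, P (pre p k, pre u l))) →
      Realizes δ sierpinski (wordFun q) fun x => {S x} := by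
  obtain ⟨f, hf, hP⟩ := exists_primrec_of_rePred hP
  let T : List ℕ × List ℕ → Bool := fun x => f ((x.1.take x.2.length.unpair.1,
    x.2.take x.2.length.unpair.2.unpair.1), x.2.length.unpair.2.unpair.2)
  have hT : Primrec T := by fun_prop
  -- Position `n` of the output holds the answer to the word with code `n`. A word is no longer than
  -- its code, so the prefix of `p` of length `n` suffices to compute that answer.
  let b : List ℕ → ℕ := fun v => Encodable.encode
    ((List.range (Denumerable.ofNat (List ℕ) v.length).length).map fun i =>
      bif T (v.take i, (Denumerable.ofNat (List ℕ) v.length).take i) then 1 else 0)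
  have hb : Primrec fun x : Unit × List ℕ => b x.2 := by
    refine Primrec.encode.comp (primrec_map ?_ ?_) <;> fun_prop
  refine ⟨monitor b, ((primrec_monitor (b := fun _ => b) hb).comp
    (g := fun w => ((), w)) (by fun_prop)).to_comp,
    fun p => ⟨_, yields_of_eq_pre (monitor_pre b p), fun δ S hS u x hu _ => ?_⟩⟩
  refine ⟨fun i => bif T (pre p i, pre u i) then 1 else 0, yields_of_eq_pre fun k => ?_, _, rfl, ?_⟩
  · simp only [wordFun, b, length_pre, Denumerable.ofNat_encode]
    change _ = (List.range k).map fun i => bif T (pre p i, pre u i) then 1 else 0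
    refine List.map_congr_left fun i hi => ?_
    have hi := List.mem_range.1 hi
    have h1 := Encodable.length_le_encode (pre u k)
    rw [length_pre] at h1
    rw [take_pre hi.le, take_pre (by omega)]
  · refine (hS u x hu).trans ?_
    have htake : ∀ i, T (pre p i, pre u i) = f ((pre p i.unpair.1, pre u i.unpair.2.unpair.1),
        i.unpair.2.unpair.2) := by
      intro i
      simp only [T, length_pre]
      rw [take_pre (Nat.unpair_left_le _),
        take_pre ((Nat.unpair_left_le _).trans (Nat.unpair_right_le _))]
    simp only [htake, hP]
    constructor
    · rintro ⟨k, l, s, hs⟩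
      exact ⟨Nat.pair k (Nat.pair l s), by simp [hs]⟩
    · rintro ⟨i, hi⟩
      cases h : f ((pre p i.unpair.1, pre u i.unpair.2.unpair.1), i.unpair.2.unpair.2)
      · simp [h] at hi
      · exact ⟨_, _, _, h⟩

end

/-! ### Separability, overtness and the extendability predicate -/

section

variable {X : Type*}

theorem computable_pre {α : Type*} [Primcodable α] {w : α → ℕ → ℕ} {k : α → ℕ}
    (hw : Computable fun x : α × ℕ => w x.1 x.2) (hk : Computable k) :
    Computable fun a => pre (w a) (k a) := by
  refine (Computable.nat_rec (g := fun _ => ([] : List ℕ))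
    (h := fun a (x : ℕ × List ℕ) => x.2 ++ [w a x.1]) hk (Computable.const _) ?_).of_eq fun a => ?_
  · exact Computable.list_concat.comp (by fun_prop)
      (hw.comp (g := fun y : α × (ℕ × List ℕ) => (y.1, y.2.1)) (by fun_prop))
  · induction k a with
    | zero => rfl
    | succ n ih => rw [pre_succ, ← ih]

/-- By density, non-emptiness of `U` is witnessed by some `a n`, and one can search for `n` together
with a confirmation. -/
theorem EffectivelySeparable.computablyOvert {δ : Representation X} (h : EffectivelySeparable δ) :
    ComputablyOvert δ := by
  obtain ⟨a, ⟨g, hg, Hg⟩, ha⟩ := h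
  -- The mapped range is a prefix of the constant sequence `n`, which is a name of `n`; truncating
  -- at `l` reaches every prefix of the resulting name of `a n`.
  have hP : REPred fun x : Unit × List ℕ => ∃ n k l,
      hit x.2 ((g ((List.range k).map fun _ => n)).take l) = true := by
    have h1 : Primrec fun y : ((Unit × List ℕ) × ℕ) × ℕ => (List.range y.2).map fun _ => y.1.2 :=
      primrec_map (by fun_prop) (by fun_prop)
    have h2 := hg.comp h1.to_comp
    exact (rePred_of_bool (f := fun y : (((Unit × List ℕ) × ℕ) × ℕ) × ℕ =>
      hit y.1.1.1.2 ((g ((List.range y.1.2).map fun _ => y.1.1.2)).take y.2))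
      (computable_hit (by fun_prop) (computable_take (by fun_prop) (h2.comp Computable.fst)))).exists_nat.exists_nat.exists_nat
  obtain ⟨u, hu, Hu⟩ := exists_primrec_names (X := Opens δ) hP
  refine ⟨u (), (hu.comp (g := fun n => ((), n)) (by fun_prop)).to_comp,
    Hu () (opens δ) (fun U => ∃ x ∈ Set.univ, U.1 x) fun p U hp => ?_⟩
  have hmem : ∀ n, U.1 (a n) ↔ ∃ k i l, hit (pre p i)
      ((g ((List.range k).map fun _ => n)).take l) = true := by
    intro n
    obtain ⟨q, hq, _, rfl, hqn⟩ := Hg (fun _ => n) n rfl ⟨_, rfl⟩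
    rw [Opens.names_iff hp hqn]
    constructor
    · rintro ⟨i, m, hm⟩
      obtain ⟨k, hk⟩ := (yields_prefix hq).1 ⟨m, rfl⟩
      rw [List.prefix_iff_eq_take] at hk
      exact ⟨k, i, _, hk ▸ hm⟩
    · rintro ⟨k, i, l, hl⟩
      obtain ⟨m, hm⟩ := (yields_prefix hq).2 ⟨k, List.take_prefix l _⟩
      exact ⟨i, m, hm ▸ hl⟩
  constructor
  · rintro ⟨x, -, hx⟩
    obtain ⟨n, hn⟩ := ha U ⟨x, hx⟩
    obtain ⟨k, i, l, h⟩ := (hmem n).1 hn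
    exact ⟨i, n, k, l, h⟩
  · rintro ⟨i, n, k, l, h⟩
    exact ⟨a n, trivial, (hmem n).2 ⟨k, i, l, h⟩⟩

/-- Membership of numbers in points of a space of sets is a uniformly open property. -/
theorem exists_primrec_names_mem {δ : Representation X} {I : X → Set ℕ} {g : List ℕ → List ℕ}
    (hg : Computable g)
    (H : ∀ p x, δ.Names p x → ∃ q, Yields g p q ∧ enumNat.Names q (I x)) :
    ∃ u : ℕ → ℕ → ℕ, Primrec (fun x : ℕ × ℕ => u x.1 x.2) ∧
      ∀ n, Realizes δ sierpinski (wordFun (u n)) fun x => {n ∈ I x} := by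
  have hP : REPred fun x : ℕ × List ℕ => ∃ i : ℕ, decide ((g x.2)[i]? = some (x.1 + 1)) = true := by
    refine (rePred_of_bool (f := fun y : (ℕ × List ℕ) × ℕ =>
      decide ((g y.1.2)[y.2]? = some (y.1.1 + 1))) ?_).exists_nat
    have h1 : Computable fun y : (ℕ × List ℕ) × ℕ => (g y.1.2)[y.2]? :=
      Computable.list_getElem?.comp (by fun_prop) (by fun_prop)
    exact Primrec.eq.decide.to_comp.comp h1 (Primrec.to_comp (by fun_prop))
  obtain ⟨u, hu, Hu⟩ := exists_primrec_names (X := X) hP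
  refine ⟨u, hu, fun n => Hu n δ (fun x => n ∈ I x) fun p x hp => ?_⟩
  obtain ⟨q, hq, hqI⟩ := H p x hp
  refine (hqI n).trans ?_
  simp only [yields_getElem? hq, decide_eq_true_eq]
  exact exists_comm

/-- A number is extendable exactly when the open set of points whose ideal contains it is non-empty.
Names of these sets are computable uniformly in the number, so overtness semi-decides this. -/
theorem ComputablyOvert.rePred_extendable {δ : Representation X} (h : ComputablyOvert δ)
    {r : ℕ → ℕ → Prop} (hr : ComputablyIsomorphic δ (roundedIdeals r)) :
    REPred (Extendable r) := by
  obtain ⟨w, hw, Hw⟩ := h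
  obtain ⟨e, ⟨g, hg, Hg⟩, -⟩ := hr
  obtain ⟨u, hu, Hu⟩ := exists_primrec_names_mem (δ := δ) (I := fun x => (e x).1) hg
    fun p x hp => by
      obtain ⟨q, hq, _, rfl, hqe⟩ := Hg p x hp ⟨_, rfl⟩
      exact ⟨q, hq, hqe⟩
  let U (n : ℕ) : Opens δ := ⟨fun x => n ∈ (e x).1, _, Hu n⟩
  have hP : REPred fun n => ∃ k l, hit (pre w k) (pre (u n) l) = true := by
    have h1 : Computable fun x : (ℕ × ℕ) × ℕ => pre w x.1.2 :=
      computable_pre (w := fun _ => w) (by fun_prop) (by fun_prop)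
    have h2 : Computable fun x : (ℕ × ℕ) × ℕ => pre (u x.1.1) x.2 :=
      computable_pre (w := fun x : (ℕ × ℕ) × ℕ => u x.1.1) (hu.to_comp.comp
        (g := fun y : ((ℕ × ℕ) × ℕ) × ℕ => (y.1.1.1, y.2)) (by fun_prop)) (by fun_prop)
    exact (rePred_of_bool (f := fun x : (ℕ × ℕ) × ℕ => hit (pre w x.1.2) (pre (u x.1.1) x.2))
      (by fun_prop)).exists_nat.exists_nat
  refine hP.of_eq fun n => ?_
  rw [← Opens.names_iff (U := (hits δ Set.univ).1) Hw (x := U n) (Hu n)]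
  constructor
  · rintro ⟨x, -, hx⟩
    exact ⟨_, (e x).2, hx⟩
  · rintro ⟨I, hI, hn⟩
    refine ⟨e.symm ⟨I, hI⟩, trivial, ?_⟩
    change n ∈ (e (e.symm ⟨I, hI⟩)).1
    rwa [e.apply_symm_apply]

end

/-! ### Total representations of spaces of rounded ideals -/

theorem extendZero_pre {p : ℕ → ℕ} {n i : ℕ} (h : i < n) : extendZero (pre p n) i = p i := by
  rw [extendZero, List.getD_eq_getElem?_getD, getElem?_pre h, Option.getD_some]

theorem extendZero_append {u v : List ℕ} {i : ℕ} (h : i < u.length) :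
    extendZero (u ++ v) i = extendZero u i := by
  simp [extendZero, List.getElem?_append_left h]

theorem IsRoundedIdeal.extendable {r : ℕ → ℕ → Prop} {I : Set ℕ} (hI : IsRoundedIdeal r I) {n : ℕ}
    (hn : n ∈ I) : Extendable r n := ⟨I, hI, hn⟩

/-- A computable coding of the `r`-increasing sequences by all points of Baire space. -/
structure ChainCoding (r : ℕ → ℕ → Prop) where
  /-- The `i`-th member of the sequence coded by `p`. -/
  Z : (ℕ → ℕ) → ℕ → ℕ
  computable : Computable fun x : List ℕ × ℕ => Z (extendZero x.1) x.2
  congr : ∀ {p q : ℕ → ℕ} {i : ℕ}, (∀ j ≤ i, p j = q j) → Z p i = Z q i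
  step : ∀ p i, r (Z p i) (Z p (i + 1))
  extend : ∀ (u : List ℕ) z, Extendable r z →
    (∀ i, u.length = i + 1 → r (Z (extendZero u) i) z) →
    ∃ a, Z (extendZero (u ++ [a])) u.length = z

/-- Chains are followed through indices in an enumeration of the extendable numbers. A letter is a
proposed next index paired with a stage that should confirm the relation; unconfirmed proposals are
replaced by a default found by search. -/
theorem nonempty_chainCoding {r : ℕ → ℕ → Prop} (hr : IsCE₂ r) (hE : REPred (Extendable r))
    (hne : ∃ n, Extendable r n) : Nonempty (ChainCoding r) := by
  obtain ⟨en, hen, Hen⟩ := exists_computable_range hE hne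
  obtain ⟨f, hf, Hf⟩ := exists_primrec_of_rePred hr
  have hf := hf.to_comp
  have hf' : Computable fun x : ℕ × ℕ => f ((en x.1, en x.2.unpair.1), x.2.unpair.2) := by
    have : Computable fun x : ℕ × ℕ => x.2.unpair := Primrec.to_comp (by fun_prop)
    fun_prop
  -- The search for a default successor terminates: roundedness of an ideal containing `en i`
  -- provides an extendable number above it.
  obtain ⟨first, hfirst, Hfirst⟩ := exists_computable_choice (α := ℕ) hf' fun i => by
    obtain ⟨I, hI, hi⟩ := (Hen (en i)).2 ⟨i, rfl⟩
    obtain ⟨z, hz, hiz, -⟩ := hI.2.2 _ _ hi hi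
    obtain ⟨j, rfl⟩ := (Hen z).1 (hI.extendable hz)
    obtain ⟨s, hs⟩ := (Hf (en i, en j)).1 hiz
    exact ⟨Nat.pair j s, by simpa using hs⟩
  let next (i t : ℕ) : ℕ :=
    bif f ((en i, en t.unpair.1), t.unpair.2) then t.unpair.1 else (first i).unpair.1
  have hnext : Computable fun x : ℕ × ℕ => next x.1 x.2 := by
    refine Computable.cond hf' (Primrec.to_comp (by fun_prop)) ?_
    exact Computable.fst.comp (Computable.unpair.comp (by fun_prop))
  have next_step : ∀ i t, r (en i) (en (next i t)) := by
    intro i t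
    cases h : f ((en i, en t.unpair.1), t.unpair.2)
    · simp only [next, h, cond_false]
      exact (Hf _).2 ⟨_, Hfirst i⟩
    · simp only [next, h, cond_true]
      exact (Hf (en i, _)).2 ⟨_, h⟩
  let chain (p : ℕ → ℕ) (n : ℕ) : ℕ := Nat.rec (p 0) (fun i s => next s (p (i + 1))) n
  refine ⟨fun p i => en (chain p i), ?_, ?_, fun p i => next_step _ _, ?_⟩
  · have hz : Computable fun x : List ℕ × ℕ => extendZero x.1 x.2 :=
      Primrec.to_comp (by unfold extendZero; fun_prop)
    refine hen.comp (Computable.nat_rec (g := fun x : List ℕ × ℕ => extendZero x.1 0)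
      (h := fun (x : List ℕ × ℕ) (y : ℕ × ℕ) => next y.2 (extendZero x.1 (y.1 + 1)))
      (by fun_prop) (hz.comp (g := fun x : List ℕ × ℕ => (x.1, 0)) (by fun_prop)) ?_)
    refine hnext.comp (g := fun y : (List ℕ × ℕ) × (ℕ × ℕ) =>
      (y.2.2, extendZero y.1.1 (y.2.1 + 1))) ?_
    have := hz.comp (g := fun y : (List ℕ × ℕ) × (ℕ × ℕ) => (y.1.1, y.2.1 + 1))
      (Primrec.to_comp (by fun_prop))
    fun_prop
  · intro p q i h
    suffices chain p i = chain q i by simp only [this]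
    induction i with
    | zero => exact h 0 le_rfl
    | succ i ih =>
      change next (chain p i) _ = next (chain q i) _
      rw [ih fun j hj => h j (hj.trans (Nat.le_succ i)), h _ le_rfl]
  · intro u z hz h
    obtain ⟨j, rfl⟩ := (Hen z).1 hz
    have hlast : ∀ a, extendZero (u ++ [a]) u.length = a := fun a => by simp [extendZero]
    rcases hu : u.length with _ | i
    · refine ⟨j, ?_⟩
      have := hlast j
      rw [hu] at this
      change en (extendZero (u ++ [j]) 0) = _
      rw [this]
    · obtain ⟨s, hs⟩ := (Hf (_, en j)).1 (h i hu)
      refine ⟨Nat.pair j s, ?_⟩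
      have hc : ∀ l ≤ i, chain (extendZero (u ++ [Nat.pair j s])) l = chain (extendZero u) l := by
        intro l hl
        induction l with
        | zero => exact extendZero_append (by omega)
        | succ l ih =>
          change next (chain _ l) _ = next (chain _ l) _
          rw [ih (by omega), extendZero_append (by omega)]
      change en (next (chain (extendZero (u ++ [Nat.pair j s])) i)
        (extendZero (u ++ [Nat.pair j s]) (i + 1))) = _
      rw [hc i le_rfl, ← hu, hlast]
      simp only [next, Nat.unpair_pair]
      rw [hs, cond_true]

namespace ChainCoding

variable {r : ℕ → ℕ → Prop} (C : ChainCoding r)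

theorem Z_append {u v : List ℕ} {i : ℕ} (h : i < u.length) :
    C.Z (extendZero (u ++ v)) i = C.Z (extendZero u) i :=
  C.congr fun _ hj => extendZero_append (by omega)

theorem Z_pre {p : ℕ → ℕ} {n i : ℕ} (h : i < n) : C.Z (extendZero (pre p n)) i = C.Z p i :=
  C.congr fun _ hj => extendZero_pre (by omega)

/-- The ideal generated by the sequence coded by `p`. -/
def ideal (p : ℕ → ℕ) : Set ℕ := {n | ∃ i, r n (C.Z p i)}

theorem lt (htrans : ∀ a b c, r a b → r b c → r a c) (p : ℕ → ℕ) {i j : ℕ} (h : i < j) :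
    r (C.Z p i) (C.Z p j) := by
  induction j, h using Nat.le_induction with
  | base => exact C.step p i
  | succ j _ ih => exact htrans _ _ _ ih (C.step p j)

theorem isRoundedIdeal (htrans : ∀ a b c, r a b → r b c → r a c) (p : ℕ → ℕ) :
    IsRoundedIdeal r (C.ideal p) := by
  refine ⟨⟨_, 1, C.step p 0⟩, fun x y ⟨i, hi⟩ hxy => ⟨i, htrans _ _ _ hxy hi⟩, ?_⟩
  rintro x y ⟨i, hi⟩ ⟨j, hj⟩
  exact ⟨C.Z p (max i j + 1), ⟨_, C.step p _⟩, htrans _ _ _ hi (C.lt htrans p (by omega)),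
    htrans _ _ _ hj (C.lt htrans p (by omega))⟩

theorem mem_ideal (p : ℕ → ℕ) (i : ℕ) : C.Z p i ∈ C.ideal p := ⟨i + 1, C.step p i⟩

/-- Roundedness gives a member of `I` above both `x` and the last chain member. It is extendable,
hence reached by a suitable letter. -/
theorem exists_extend {I : Set ℕ} (hI : IsRoundedIdeal r I) {u : List ℕ}
    (hu : ∀ i, u.length = i + 1 → C.Z (extendZero u) i ∈ I) {x : ℕ} (hx : x ∈ I) :
    ∃ a, C.Z (extendZero (u ++ [a])) u.length ∈ I ∧
      r x (C.Z (extendZero (u ++ [a])) u.length) := by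
  obtain ⟨z, hz, hxz, hz'⟩ : ∃ z ∈ I, r x z ∧
      ∀ i, u.length = i + 1 → r (C.Z (extendZero u) i) z := by
    rcases h : u.length with _ | i
    · obtain ⟨z, hz, hxz, -⟩ := hI.2.2 x x hx hx
      exact ⟨z, hz, hxz, by simp⟩
    · obtain ⟨z, hz, hxz, hiz⟩ := hI.2.2 x _ hx (hu i h)
      exact ⟨z, hz, hxz, by simpa using hiz⟩
  obtain ⟨a, ha⟩ := C.extend u z (hI.extendable hz) hz'
  exact ⟨a, ha ▸ hz, ha ▸ hxz⟩

/-- List `I` as `x 0, x 1, …` and extend `w` within `I` so that the `k`-th new chain member lies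
above `x k`. The chain is then cofinal in `I`. Only the last member of `w` needs to be in `I`,
because the earlier ones lie below it. -/
theorem exists_ideal_eq (htrans : ∀ a b c, r a b → r b c → r a c) {I : Set ℕ}
    (hI : IsRoundedIdeal r I) {w : List ℕ}
    (hw : ∀ i, w.length = i + 1 → C.Z (extendZero w) i ∈ I) :
    ∃ p, pre p w.length = w ∧ C.ideal p = I := by
  obtain ⟨x, hx⟩ := (Set.countable_univ.mono (Set.subset_univ I)).exists_eq_range hI.1
  have hxI : ∀ k, x k ∈ I := fun k => hx ▸ Set.mem_range_self k
  let W := {u : List ℕ // ∀ i, u.length = i + 1 → C.Z (extendZero u) i ∈ I}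
  have hnext : ∀ (u : W) (k : ℕ), ∃ v : W, u.1 <+: v.1 ∧ v.1.length = u.1.length + 1 ∧
      r (x k) (C.Z (extendZero v.1) u.1.length) := by
    intro u k
    obtain ⟨a, ha, hxa⟩ := C.exists_extend hI u.2 (hxI k)
    refine ⟨⟨u.1 ++ [a], fun i hi => ?_⟩, List.prefix_append _ _, by simp, hxa⟩
    obtain rfl : u.1.length = i := by simpa using hi
    exact ha
  choose next h1 h2 h3 using hnext
  let s (k : ℕ) : W := Nat.rec ⟨w, hw⟩ (fun k u => next u k) k
  have hs : ∀ k, (s k).1.length = w.length + k := by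
    intro k
    induction k with
    | zero => rfl
    | succ k ih =>
      change (next (s k) k).1.length = _
      rw [h2, ih]
      rfl
  obtain ⟨p, hp⟩ := exists_limit_word (fun k => (s k).1) (fun k => h1 (s k) k) fun n =>
    ⟨n, by rw [hs]; omega⟩
  have hZ : ∀ k, C.Z p (w.length + k) ∈ I ∧ r (x k) (C.Z p (w.length + k)) := by
    intro k
    have hl : w.length + k < (s (k + 1)).1.length :=
      lt_of_lt_of_eq (by omega) (hs (k + 1)).symm
    have h4 : r (x k) (C.Z (extendZero (s (k + 1)).1) (s k).1.length) := h3 (s k) k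
    have h5 := (s (k + 1)).2 (w.length + k) (hs (k + 1))
    rw [hp (k + 1), C.Z_pre hl] at h5
    rw [hs k, hp (k + 1), C.Z_pre hl] at h4
    exact ⟨h5, h4⟩
  refine ⟨p, (hp 0).symm, Set.ext fun n => ⟨?_, fun hn => ?_⟩⟩
  · rintro ⟨i, hi⟩
    refine hI.2.1 _ _ (hZ (i + 1)).1 (htrans _ _ _ hi (C.lt htrans p (by omega)))
  · rw [hx] at hn
    obtain ⟨k, rfl⟩ := hn
    exact ⟨_, (hZ k).2⟩

/-- The total representation of a space of rounded ideals, transported along a bijection. -/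
def representation {X : Type*} (htrans : ∀ a b c, r a b → r b c → r a c)
    (e : X ≃ {I : Set ℕ // IsRoundedIdeal r I}) : Representation X where
  Names p x := C.ideal p = (e x).1
  unique h h' := e.injective (Subtype.ext (h.symm.trans h'))
  surj x := by
    obtain ⟨n, hn⟩ := (e x).2.1
    obtain ⟨p, -, hp⟩ := C.exists_ideal_eq htrans (e x).2 (w := []) (by simp)
    exact ⟨p, hp⟩

/-! ### Properties of the representation by chains. -/

section Representation

variable {X : Type*} (htrans : ∀ a b c, r a b → r b c → r a c)
  (e : X ≃ {I : Set ℕ // IsRoundedIdeal r I})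

theorem isTotal_representation : (C.representation htrans e).IsTotal := fun p =>
  ⟨e.symm ⟨_, C.isRoundedIdeal htrans p⟩, by simp [representation]⟩

theorem isComputable_toIdeals (hr : IsCE₂ r) :
    IsComputable (C.representation htrans e) (roundedIdeals r) e := by
  have hC := C.computable
  have hP : REPred fun x : ℕ × List ℕ => ∃ i : ℕ, decide (i < x.2.length) = true ∧
      r x.1 (C.Z (extendZero x.2) i) := by
    have h1 : Computable fun y : (ℕ × List ℕ) × ℕ => C.Z (extendZero y.1.2) y.2 :=
      hC.comp (g := fun y : (ℕ × List ℕ) × ℕ => (y.1.2, y.2)) (by fun_prop)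
    refine REPred.exists_nat (P := fun y : (ℕ × List ℕ) × ℕ => decide (y.2 < y.1.2.length) = true ∧
      r y.1.1 (C.Z (extendZero y.1.2) y.2)) (REPred.and ?_ ?_)
    · exact rePred_of_bool (Primrec.to_comp (by fun_prop))
    · exact hr.comp (g := fun y : (ℕ × List ℕ) × ℕ => (y.1.1, C.Z (extendZero y.1.2) y.2))
        (by fun_prop)
  obtain ⟨h, hh, H⟩ := exists_computable_enum hP
  refine ⟨h, hh, fun p x hp _ => ?_⟩
  obtain ⟨q, hq, hqI⟩ := H p (e x).1 fun n => by
    rw [← show C.ideal p = (e x).1 from hp]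
    constructor
    · rintro ⟨i, hi⟩
      exact ⟨i + 1, i, by simp [length_pre], by rwa [C.Z_pre (Nat.lt_succ_self i)]⟩
    · rintro ⟨k, i, hi, h⟩
      rw [decide_eq_true_eq, length_pre] at hi
      rw [C.Z_pre hi] at h
      exact ⟨i, h⟩
  exact ⟨q, hq, _, rfl, hqI⟩

/-- This is the acceptance condition for the next letter when an enumeration of an ideal is turned
into a chain: the new member has already been listed, and it lies above the number listed at the
current position, if there is one. -/
theorem rePred_extension (hr : IsCE₂ r) : REPred fun x : (List ℕ × List ℕ) × ℕ =>
    (decide (x.1.2.length < x.1.1.length) &&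
      decide (C.Z (extendZero (x.1.2 ++ [x.2])) x.1.2.length + 1 ∈ x.1.1)) = true ∧
    (decide (x.1.1.getD x.1.2.length 0 = 0) = true ∨
      r (x.1.1.getD x.1.2.length 0 - 1) (C.Z (extendZero (x.1.2 ++ [x.2])) x.1.2.length)) := by
  obtain ⟨Z, hZ, hZC⟩ : ∃ Z : (List ℕ × List ℕ) × ℕ → ℕ, Computable Z ∧
      ∀ x, C.Z (extendZero (x.1.2 ++ [x.2])) x.1.2.length = Z x :=
    ⟨_, C.computable.comp (g := fun x : (List ℕ × List ℕ) × ℕ => (x.1.2 ++ [x.2], x.1.2.length))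
      (Primrec.to_comp (by fun_prop)), fun _ => rfl⟩
  simp only [hZC]
  refine REPred.and (rePred_of_bool ?_) (REPred.or (rePred_of_bool ?_) ?_)
  · have : Primrec fun y : ((List ℕ × List ℕ) × ℕ) × ℕ =>
        decide (y.1.1.2.length < y.1.1.1.length) && decide (y.2 + 1 ∈ y.1.1.1) := by fun_prop
    exact this.to_comp.comp (g := fun x => (x, Z x)) (Computable.id.pair hZ)
  · exact Primrec.to_comp (by fun_prop)
  · have : Computable fun x : (List ℕ × List ℕ) × ℕ => x.1.1.getD x.1.2.length 0 - 1 :=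
      Primrec.to_comp (by fun_prop)
    exact hr.comp (g := fun x : (List ℕ × List ℕ) × ℕ =>
      (x.1.1.getD x.1.2.length 0 - 1, Z x)) (by fun_prop)

/-- The `i`-th letter is chosen so that the chain stays in the ideal and its `i`-th member dominates
the entry at position `i` of the enumeration. Every element is listed somewhere, so the chain
generates the ideal. -/
theorem isComputable_ofIdeals (hr : IsCE₂ r) :
    IsComputable (roundedIdeals r) (C.representation htrans e) e.symm := by
  obtain ⟨h, hh, H⟩ := exists_computable_extension (C.rePred_extension hr)
  refine ⟨h, hh, fun p I hp _ => ?_⟩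
  have hp : ∀ n, n ∈ I.1 ↔ ∃ i, p i = n + 1 := hp
  have hgetD : ∀ {k i : ℕ}, i < k → (pre p k).getD i 0 = p i := fun h => extendZero_pre h
  let Inv (u : List ℕ) : Prop := ∀ i < u.length, C.Z (extendZero u) i ∈ I.1 ∧
    ∀ m, p i = m + 1 → r m (C.Z (extendZero u) i)
  obtain ⟨q, hq, hInv⟩ := H p Inv (by simp [Inv])
    (by
      intro u hu
      obtain ⟨x, hx, hpx⟩ : ∃ x ∈ I.1, ∀ m, p u.length = m + 1 → x = m := by
        rcases h : p u.length with _ | m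
        · obtain ⟨x, hx⟩ := I.2.1
          exact ⟨x, hx, by simp⟩
        · exact ⟨m, (hp m).2 ⟨_, h⟩, by simp⟩
      obtain ⟨a, ha, hxa⟩ := C.exists_extend I.2 (u := u) (fun i hi => (hu i (by omega)).1) hx
      obtain ⟨j, hj⟩ := (hp _).1 ha
      -- This prefix shows both position `j`, where the new member is listed, and position
      -- `u.length`, whose entry has to be dominated.
      refine ⟨a, max j u.length + 1, ?_, ?_⟩
      · simp only [length_pre, Bool.and_eq_true, decide_eq_true_eq]
        refine ⟨by omega, ?_⟩
        rw [← hj]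
        exact List.mem_of_getElem? (getElem?_pre (i := j) (by omega))
      · simp only [hgetD (show u.length < max j u.length + 1 by omega), decide_eq_true_eq]
        rcases h : p u.length with _ | m
        · exact Or.inl rfl
        · right
          rw [Nat.add_sub_cancel, ← hpx m h]
          exact hxa)
    (by
      intro u k a hu ha i hi
      simp only [length_pre, Bool.and_eq_true, decide_eq_true_eq] at ha
      rw [List.length_append, List.length_singleton] at hi
      rcases Nat.lt_succ_iff_lt_or_eq.1 hi with hi | rfl
      · rw [C.Z_append hi]
        exact hu i hi
      · obtain ⟨⟨hlt, hmem⟩, hor⟩ := ha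
        rw [hgetD hlt] at hor
        refine ⟨?_, fun m hm => ?_⟩
        · obtain ⟨j, hj⟩ := List.mem_iff_getElem?.1 hmem
          have hjk := (List.getElem?_eq_some_iff.1 hj).1
          rw [length_pre] at hjk
          rw [getElem?_pre hjk, Option.some.injEq] at hj
          exact (hp _).2 ⟨j, hj⟩
        · rw [hm] at hor
          simpa using hor)
  refine ⟨q, hq, _, rfl, ?_⟩
  have hZ : ∀ i, C.Z q i ∈ I.1 ∧ ∀ m, p i = m + 1 → r m (C.Z q i) := fun i => by
    have := hInv (i + 1) i (by simp [length_pre])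
    rwa [C.Z_pre (Nat.lt_succ_self i)] at this
  change C.ideal q = (e (e.symm I)).1
  rw [e.apply_symm_apply]
  refine Set.ext fun n => ⟨?_, fun hn => ?_⟩
  · rintro ⟨i, hi⟩
    exact I.2.2.1 _ _ (hZ i).1 hi
  · obtain ⟨i, hi⟩ := (hp n).1 hn
    exact ⟨i, (hZ i).2 n hi⟩

/-- An open set meets the fiber exactly when it is hit by a word that is empty or whose last chain
member lies in the ideal: by `exists_ideal_eq`, these are the words that extend to names. -/
theorem effectivelyFiberOvert_representation (hr : IsCE₂ r) :
    EffectivelyFiberOvert (C.representation htrans e) := by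
  have hP : REPred fun x : List ℕ × List ℕ => ∃ w, hit x.2 w = true ∧
      (decide (w.length = 0) = true ∨ ∃ i, decide (i < x.1.length) = true ∧
        r (C.Z (extendZero w) (w.length - 1)) (C.Z (extendZero x.1) i)) := by
    refine REPred.exists_list (P := fun y : (List ℕ × List ℕ) × List ℕ => hit y.1.2 y.2 = true ∧
      (decide (y.2.length = 0) = true ∨ ∃ i, decide (i < y.1.1.length) = true ∧
        r (C.Z (extendZero y.2) (y.2.length - 1)) (C.Z (extendZero y.1.1) i)))
      (REPred.and (rePred_of_bool (Primrec.to_comp (by fun_prop)))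
        (REPred.or (rePred_of_bool (Primrec.to_comp (by fun_prop))) ?_))
    refine REPred.exists_nat (P := fun z : ((List ℕ × List ℕ) × List ℕ) × ℕ =>
      decide (z.2 < z.1.1.1.length) = true ∧
        r (C.Z (extendZero z.1.2) (z.1.2.length - 1)) (C.Z (extendZero z.1.1.1) z.2))
      (REPred.and (rePred_of_bool (Primrec.to_comp (by fun_prop))) ?_)
    have h1 := C.computable.comp (g := fun z : ((List ℕ × List ℕ) × List ℕ) × ℕ =>
      (z.1.2, z.1.2.length - 1)) (Primrec.to_comp (by fun_prop))
    have h2 := C.computable.comp (g := fun z : ((List ℕ × List ℕ) × List ℕ) × ℕ =>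
      (z.1.1.1, z.2)) (Primrec.to_comp (by fun_prop))
    exact hr.comp (h1.pair h2)
  obtain ⟨h, hh, H⟩ := exists_computable_curry (X := Opens baire) hP
  refine ⟨h, hh, fun p x hp _ => ?_⟩
  obtain ⟨q, hq, Hq⟩ := H p
  refine ⟨q, hq, _, rfl, Hq (opens baire)
    (fun U => ∃ p' ∈ {p' | (C.representation htrans e).Names p' x}, U.1 p') fun u U hu => ?_⟩
  have hp : C.ideal p = (e x).1 := hp
  have hmem : ∀ n, n ∈ (e x).1 ↔ ∃ k i, decide (i < (pre p k).length) = true ∧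
      r n (C.Z (extendZero (pre p k)) i) := by
    intro n
    rw [← hp]
    constructor
    · rintro ⟨i, hi⟩
      exact ⟨i + 1, i, by simp [length_pre], by rwa [C.Z_pre (Nat.lt_succ_self i)]⟩
    · rintro ⟨k, i, hi, h⟩
      rw [decide_eq_true_eq, length_pre] at hi
      rw [C.Z_pre hi] at h
      exact ⟨i, h⟩
  constructor
  · rintro ⟨p', hp', hU⟩
    have hp' : C.ideal p' = (e x).1 := hp'
    obtain ⟨l, j, hl⟩ := (Opens.names_iff (p := p') hu rfl).1 hU
    rcases j with _ | j
    · exact ⟨0, l, _, hl, Or.inl rfl⟩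
    · have : C.Z p' j ∈ (e x).1 := hp' ▸ C.mem_ideal p' j
      obtain ⟨k, i, hi, h⟩ := (hmem _).1 this
      refine ⟨k, l, _, hl, Or.inr ⟨i, hi, ?_⟩⟩
      rwa [length_pre, Nat.add_sub_cancel, C.Z_pre (Nat.lt_succ_self j)]
  · rintro ⟨k, l, w, hw, hor⟩
    obtain ⟨p', hpre, hp'⟩ := C.exists_ideal_eq htrans (e x).2 (w := w) fun i hi => by
      rcases hor with h0 | h1
      · simp [hi] at h0
      · rw [hi, Nat.add_sub_cancel] at h1
        exact (hmem _).2 ⟨k, h1⟩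
    exact ⟨p', hp', (Opens.names_iff (p := p') hu rfl).2 ⟨l, w.length, by rwa [hpre]⟩⟩

/-- The filter of `x` contains the open set of points whose ideal contains `n` exactly when `n` is
in the ideal of `x`. So the filter enumerates the ideal, from which a name is computed. -/
theorem computablyAdmissible_representation (hr : IsCE₂ r) :
    ComputablyAdmissible (C.representation htrans e) := by
  obtain ⟨g, hg, Hg⟩ := C.isComputable_toIdeals htrans e hr
  obtain ⟨u, hu, Hu⟩ := exists_primrec_names_mem (δ := C.representation htrans e)
    (I := fun x => (e x).1) hg fun p x hp => by
      obtain ⟨q, hq, _, rfl, hqe⟩ := Hg p x hp ⟨_, rfl⟩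
      exact ⟨q, hq, hqe⟩
  let U (n : ℕ) : Opens (C.representation htrans e) := ⟨fun x => n ∈ (e x).1, _, Hu n⟩
  have hU : ∀ x n, n ∈ (e x).1 ↔ (nhdFilter (C.representation htrans e) x).1 (U n) :=
    fun _ _ => Iff.rfl
  refine ⟨fun x y hxy => e.injective (Subtype.ext (Set.ext fun n => ?_)), ?_⟩
  · rw [hU, hU, hxy]
  have key : IsComputableMulti (opens (opens (C.representation htrans e))) (roundedIdeals r)
      fun W => {I | nhdFilter (C.representation htrans e) (e.symm I) = W} := by
    have hP : REPred fun x : ℕ × List ℕ => ∃ l, hit x.2 (pre (u x.1) l) = true := by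
      have h1 : Computable fun y : (ℕ × List ℕ) × ℕ => pre (u y.1.1) y.2 :=
        computable_pre (w := fun y : (ℕ × List ℕ) × ℕ => u y.1.1) (hu.to_comp.comp
          (g := fun z : ((ℕ × List ℕ) × ℕ) × ℕ => (z.1.1.1, z.2)) (by fun_prop)) (by fun_prop)
      exact (rePred_of_bool (f := fun y : (ℕ × List ℕ) × ℕ => hit y.1.2 (pre (u y.1.1) y.2))
        (by fun_prop)).exists_nat
    obtain ⟨h, hh, H⟩ := exists_computable_enum hP
    refine ⟨h, hh, fun p W hp hne => ?_⟩
    obtain ⟨I, rfl⟩ := hne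
    obtain ⟨q, hq, hqI⟩ := H p I.1 fun n => by
      have := hU (e.symm I) n
      rw [e.apply_symm_apply] at this
      rw [this]
      exact Opens.names_iff (δ := opens (C.representation htrans e)) hp (x := U n) (Hu n)
    exact ⟨q, hq, I, rfl, hqI⟩
  have := key.comp_right (C.isComputable_ofIdeals htrans e hr)
  convert this using 2 with W
  ext x
  constructor
  · intro h
    exact ⟨e x, by simpa using h, e.symm_apply_apply x⟩
  · rintro ⟨I, hI, rfl⟩
    exact hI

end Representation

end ChainCoding

theorem exists_total_representation {X : Type*} [Nonempty X] {δ : Representation X}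
    {r : ℕ → ℕ → Prop} (htrans : ∀ a b c, r a b → r b c → r a c) (hr : IsCE₂ r)
    (hiso : ComputablyIsomorphic δ (roundedIdeals r)) (hE : REPred (Extendable r)) :
    ∃ δ' : Representation X, Equivalent δ δ' ∧
      EffectivelyFiberOvert δ' ∧ ComputablyAdmissible δ' ∧ δ'.IsTotal := by
  obtain ⟨e, he, he'⟩ := hiso
  obtain ⟨x⟩ := ‹Nonempty X›
  -- Non-emptiness of `X` is needed here: without an extendable number there are no chains to code.
  obtain ⟨n, hn⟩ := (e x).2.1
  obtain ⟨C⟩ := nonempty_chainCoding hr hE ⟨n, (e x).2.extendable hn⟩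
  refine ⟨C.representation htrans e, ⟨?_, ?_⟩, C.effectivelyFiberOvert_representation htrans e hr,
    C.computablyAdmissible_representation htrans e hr, C.isTotal_representation htrans e⟩
  · have := (C.isComputable_ofIdeals htrans e hr).comp he
    simp only [Equiv.symm_apply_apply] at this
    exact this
  · have := he'.comp (C.isComputable_toIdeals htrans e hr)
    simp only [Equiv.symm_apply_apply] at this
    exact this

/-! ### Effectively fiber-overt total representations -/

/-- The word `w` can be extended to a name of `x`. -/
def Meets {X : Type*} (δ : Representation X) (w : List ℕ) (x : X) : Prop :=
  ∃ p, δ.Names p x ∧ pre p w.length = w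

theorem meets_pre {X : Type*} {δ : Representation X} {p : ℕ → ℕ} {x : X} (hp : δ.Names p x)
    (k : ℕ) : Meets δ (pre p k) x := ⟨p, hp, by rw [length_pre]⟩

/-- A relation that decides on the basis of a prefix of a name of `x` whether `Meets δ w x`. -/
structure IsMeetRelation {X : Type*} (δ : Representation X) (R : List ℕ × List ℕ → Bool) :
    Prop where
  primrec : Primrec R
  mono : ∀ w v v', v <+: v' → R (w, v) = true → R (w, v') = true
  meets_iff : ∀ {p x}, δ.Names p x → ∀ w, Meets δ w x ↔ ∃ k, R (w, pre p k) = true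

/-- A word extends to a name of `x` exactly when its cylinder meets the fiber of `x`. Cylinders have
uniformly computable names, so the overt fiber semi-decides this. -/
theorem EffectivelyFiberOvert.exists_isMeetRelation {X : Type*} {δ : Representation X}
    (hδ : EffectivelyFiberOvert δ) : ∃ R, IsMeetRelation δ R := by
  obtain ⟨h, hh, H⟩ := hδ
  have hcyl : REPred fun x : List ℕ × List ℕ => decide (x.1 <+: x.2) = true :=
    rePred_of_bool (Primrec.to_comp (by fun_prop))
  obtain ⟨u, hu, Hu⟩ := exists_primrec_names (X := ℕ → ℕ) hcyl
  have hU : ∀ w, Realizes baire sierpinski (wordFun (u w)) fun p => {pre p w.length = w} := by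
    refine fun w => Hu w baire (fun p => pre p w.length = w) ?_
    rintro p _ rfl
    simp only [decide_eq_true_eq]
    exact ⟨fun h => ⟨_, (congrArg (w <+: ·) h).mpr (List.prefix_refl _)⟩,
      fun ⟨k, hk⟩ => (eq_pre_of_prefix hk).symm⟩
  let U (w : List ℕ) : Opens baire := ⟨fun p => pre p w.length = w, _, hU w⟩
  have hP : REPred fun x : List ℕ × List ℕ =>
      ∃ m l, hit ((h x.2).take m) (pre (u x.1) l) = true := by
    have h1 : Computable fun y : ((List ℕ × List ℕ) × ℕ) × ℕ => pre (u y.1.1.1) y.2 :=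
      computable_pre (w := fun y : ((List ℕ × List ℕ) × ℕ) × ℕ => u y.1.1.1)
        (hu.to_comp.comp (g := fun z : (((List ℕ × List ℕ) × ℕ) × ℕ) × ℕ =>
          (z.1.1.1.1, z.2)) (Primrec.to_comp (by fun_prop))) (by fun_prop)
    exact (rePred_of_bool (f := fun y : ((List ℕ × List ℕ) × ℕ) × ℕ =>
      hit ((h y.1.1.2).take y.1.2) (pre (u y.1.1.1) y.2)) (by fun_prop)).exists_nat.exists_nat
  obtain ⟨R, hR, hmono, hRP⟩ := exists_monotone_of_rePred hP
  refine ⟨R, hR, hmono, fun {p x} hp w => ?_⟩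
  obtain ⟨q, hq, _, rfl, hqx⟩ := H p x hp ⟨_, rfl⟩
  rw [hRP]
  change (hits baire {p | δ.Names p x}).1.1 (U w) ↔ _
  rw [Opens.names_iff (δ := opens baire) hqx (x := U w) (hU w)]
  constructor
  · rintro ⟨k, l, hkl⟩
    obtain ⟨j, hj⟩ := (yields_prefix hq).1 ⟨k, rfl⟩
    rw [List.prefix_iff_eq_take] at hj
    exact ⟨j, _, l, hj ▸ hkl⟩
  · rintro ⟨j, m, l, hl⟩
    obtain ⟨k, hk⟩ := (yields_prefix hq).2 ⟨j, List.take_prefix m _⟩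
    exact ⟨k, l, hk ▸ hl⟩

/-- The relation between finite sets of words whose rounded ideals are the neighbourhood bases of
points. -/
def below (R : List ℕ × List ℕ → Bool) (F G : List (List ℕ)) : Bool :=
  (F.all fun w => decide (w ∈ G)) && decide (F.length < G.length) && decide ([] ∈ G) &&
    (F.all fun v => (List.range F.length).all fun c =>
      !R (Denumerable.ofNat (List ℕ) c, v) || decide (Denumerable.ofNat (List ℕ) c ∈ G)) &&
    (F.all fun u => F.all fun w => G.any fun v =>
      decide (w <+: v) && decide (w.length < v.length) && R (u, v))

theorem primrec_below {R : List ℕ × List ℕ → Bool} (hR : Primrec R) :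
    Primrec fun x : List (List ℕ) × List (List ℕ) => below R x.1 x.2 := by
  unfold below
  have h3 : Primrec fun z : (((List (List ℕ) × List (List ℕ)) × List ℕ) × List ℕ) × List ℕ =>
      decide (z.1.2 <+: z.2) && decide (z.1.2.length < z.2.length) && R (z.1.1.2, z.2) :=
    primrec_and (primrec_and (primrec_decide_prefix (by fun_prop) (by fun_prop))
      (primrec_decide_lt (by fun_prop) (by fun_prop))) (hR.comp (by fun_prop))
  have h4 : Primrec fun y : ((List (List ℕ) × List (List ℕ)) × List ℕ) × List ℕ =>
      y.1.1.2.any fun v =>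
        decide (y.2 <+: v) && decide (y.2.length < v.length) && R (y.1.2, v) :=
    primrec_any (by fun_prop) h3
  have h5 : Primrec fun x : List (List ℕ) × List (List ℕ) => x.1.all fun u => x.1.all fun w =>
      x.2.any fun v => decide (w <+: v) && decide (w.length < v.length) && R (u, v) :=
    primrec_all (by fun_prop) (primrec_all (by fun_prop) h4)
  have h1 : Primrec fun x : List (List ℕ) × List (List ℕ) => x.1.all fun w => decide (w ∈ x.2) :=
    primrec_all (by fun_prop) (by fun_prop)
  have h2 : Primrec fun x : List (List ℕ) × List (List ℕ) => x.1.all fun v =>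
      (List.range x.1.length).all fun c =>
        !R (Denumerable.ofNat (List ℕ) c, v) || decide (Denumerable.ofNat (List ℕ) c ∈ x.2) := by
    refine primrec_all (by fun_prop) (primrec_all (by fun_prop) ?_)
    fun_prop
  exact primrec_and (primrec_and (primrec_and (primrec_and h1
    (primrec_decide_lt (by fun_prop) (by fun_prop))) (primrec_decide_mem (by fun_prop)
    (by fun_prop))) h2) h5

/-- Growing lengths make the lists of a rounded ideal arbitrarily long, so that the bound on codes
in the fourth clause disappears in the limit. That clause makes the words of an ideal closed under
confirmed consequences. The last clause provides proper extensions of `w` that confirm `u`. -/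
theorem below_iff {R : List ℕ × List ℕ → Bool} {F G : List (List ℕ)} :
    below R F G = true ↔ F ⊆ G ∧ F.length < G.length ∧ [] ∈ G ∧
      (∀ v ∈ F, ∀ w, Encodable.encode w < F.length → R (w, v) = true → w ∈ G) ∧
      ∀ u ∈ F, ∀ w ∈ F, ∃ v ∈ G, w <+: v ∧ w.length < v.length ∧ R (u, v) = true := by
  have h : ∀ v, (∀ c < F.length, R (Denumerable.ofNat (List ℕ) c, v) = false ∨
      Denumerable.ofNat (List ℕ) c ∈ G) ↔
      ∀ w, Encodable.encode w < F.length → R (w, v) = true → w ∈ G := by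
    intro v
    constructor
    · intro H w hw hR
      have := H _ hw
      rw [Denumerable.ofNat_encode, hR] at this
      simpa using this
    · intro H c hc
      by_cases hR : R (Denumerable.ofNat (List ℕ) c, v) = true
      · exact Or.inr (H _ (by rwa [Denumerable.encode_ofNat]) hR)
      · exact Or.inl (by simpa using hR)
  simp only [below, Bool.and_eq_true, List.all_eq_true, List.any_eq_true, decide_eq_true_eq,
    List.mem_range, Bool.or_eq_true, Bool.not_eq_true', h, and_assoc]
  rfl

/-- The relation `below` on codes of finite sets of words. -/
def belowCode (R : List ℕ × List ℕ → Bool) (n m : ℕ) : Prop :=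
  below R (Denumerable.ofNat (List (List ℕ)) n) (Denumerable.ofNat (List (List ℕ)) m) = true

/-- The clauses witnessed in the middle list persist because this list is contained in the largest
one. -/
theorem belowCode_trans {R : List ℕ × List ℕ → Bool} (a b c : ℕ) (hab : belowCode R a b)
    (hbc : belowCode R b c) : belowCode R a c := by
  obtain ⟨h1, h2, -, h4, h5⟩ := below_iff.1 hab
  obtain ⟨k1, k2, k3, -, -⟩ := below_iff.1 hbc
  refine below_iff.2 ⟨fun _ h => k1 (h1 h), h2.trans k2, k3,
    fun v hv w hw hR => k1 (h4 v hv w hw hR), fun u hu w hw => ?_⟩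
  obtain ⟨v, hv, h⟩ := h5 u hu w hw
  exact ⟨v, k1 hv, h⟩

/-! ### Points as rounded ideals of finite lists of words. -/

section Ideals

variable {X : Type*} {δ : Representation X} {R : List ℕ × List ℕ → Bool}

theorem IsMeetRelation.isCE₂ (hR : IsMeetRelation δ R) : IsCE₂ (belowCode R) := by
  have h := primrec_below hR.primrec
  have : Primrec fun x : ℕ × ℕ =>
      (Denumerable.ofNat (List (List ℕ)) x.1, Denumerable.ofNat (List (List ℕ)) x.2) := by
    fun_prop
  exact rePred_of_bool (h.comp this).to_comp

theorem IsMeetRelation.meets_of (hR : IsMeetRelation δ R) {w v : List ℕ} {x : X}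
    (h : R (w, v) = true) (hv : Meets δ v x) : Meets δ w x := by
  obtain ⟨p, hp, hpv⟩ := hv
  exact (hR.meets_iff hp w).2 ⟨v.length, by rwa [hpv]⟩

/-- A name of `x` beginning with `w` eventually confirms that `u` extends to a name of `x`. -/
theorem IsMeetRelation.exists_extension (hR : IsMeetRelation δ R) {u w : List ℕ} {x : X}
    (hu : Meets δ u x) (hw : Meets δ w x) :
    ∃ v, Meets δ v x ∧ w <+: v ∧ w.length < v.length ∧ R (u, v) = true := by
  obtain ⟨p, hp, hpw⟩ := hw
  obtain ⟨k, hk⟩ := (hR.meets_iff hp u).1 hu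
  refine ⟨pre p (max k (w.length + 1)), meets_pre hp _, ?_, ?_,
    hR.mono _ _ _ (pre_prefix_pre p (le_max_left _ _)) hk⟩
  · conv_lhs => rw [← hpw]
    exact pre_prefix_pre p (by omega)
  · rw [length_pre]
    omega

/-- The codes of the finite sets of words that can be extended to names of `x`. -/
def meetIdeal (δ : Representation X) (x : X) : Set ℕ :=
  {n | ∀ w ∈ Denumerable.ofNat (List (List ℕ)) n, Meets δ w x}

theorem encode_mem_meetIdeal {F : List (List ℕ)} {x : X} :
    Encodable.encode F ∈ meetIdeal δ x ↔ ∀ w ∈ F, Meets δ w x := by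
  simp [meetIdeal]

theorem IsMeetRelation.isRoundedIdeal (hR : IsMeetRelation δ R) (x : X) :
    IsRoundedIdeal (belowCode R) (meetIdeal δ x) := by
  classical
  refine ⟨⟨_, (encode_mem_meetIdeal (F := [])).2 (by simp)⟩,
    fun n m hm hnm w hw => hm w ((below_iff.1 hnm).1 hw), fun n m hn hm => ?_⟩
  set F := Denumerable.ofNat (List (List ℕ)) n with hF
  set G := Denumerable.ofNat (List (List ℕ)) m with hG
  have hFG : ∀ w ∈ F ++ G, Meets δ w x := fun w hw =>
    (List.mem_append.1 hw).elim (hn w) (hm w)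
  have hex : ∀ y : List ℕ × List ℕ, ∃ v, Meets δ v x ∧ (Meets δ y.1 x → Meets δ y.2 x →
      y.2 <+: v ∧ y.2.length < v.length ∧ R (y.1, v) = true) := by
    intro y
    by_cases h : Meets δ y.1 x ∧ Meets δ y.2 x
    · obtain ⟨v, hv, h⟩ := hR.exists_extension h.1 h.2
      exact ⟨v, hv, fun _ _ => h⟩
    · obtain ⟨p, hp⟩ := δ.surj x
      exact ⟨_, meets_pre hp 0, fun h1 h2 => (h ⟨h1, h2⟩).elim⟩
  choose ext hext hext' using hex
  let L := F ++ G
  -- A common upper bound is obtained by adjoining to both lists everything that `below` requires: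
  -- the empty word, the words with small codes that extend to names of `x`, and a confirming
  -- extension for every pair.
  let H := L ++ [[]] ++ ((List.range L.length).map (Denumerable.ofNat (List ℕ))).filter
    (fun w => decide (Meets δ w x)) ++ (L ×ˢ L).map ext
  have hLH : L ⊆ H := fun w hw => by simp [H, hw]
  have hsub : ∀ F' : List (List ℕ), F' ⊆ L → F'.length ≤ L.length → below R F' H = true := by
    intro F' hF' hlen
    refine below_iff.2 ⟨fun w hw => hLH (hF' hw), ?_, by simp [H], fun v hv w hw hRw => ?_,
      fun u hu w hw => ⟨ext (u, w), ?_,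
        hext' (u, w) (hFG u (hF' hu)) (hFG w (hF' hw))⟩⟩
    · simp only [H, List.length_append, List.length_singleton]
      omega
    · have h1 : Meets δ w x := hR.meets_of hRw (hFG v (hF' hv))
      have h2 : w ∈ (List.range L.length).map (Denumerable.ofNat (List ℕ)) :=
        List.mem_map.2 ⟨Encodable.encode w, List.mem_range.2 (by omega), by simp⟩
      simp only [H, List.mem_append, List.mem_filter, decide_eq_true_eq]
      exact Or.inl (Or.inr ⟨h2, h1⟩)
    · simp only [H, List.mem_append]
      exact Or.inr (List.mem_map.2 ⟨(u, w), List.mem_product.2 ⟨hF' hu, hF' hw⟩, rfl⟩)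
  refine ⟨Encodable.encode H, encode_mem_meetIdeal.2 fun w hw => ?_, ?_, ?_⟩
  · simp only [H, List.mem_append, List.mem_filter, decide_eq_true_eq, List.mem_map,
      List.mem_singleton] at hw
    rcases hw with ((hw | rfl) | ⟨-, hw⟩) | ⟨y, -, rfl⟩
    · exact hFG w hw
    · obtain ⟨p, hp⟩ := δ.surj x
      exact meets_pre hp 0
    · exact hw
    · exact hext y
  · rw [belowCode, Denumerable.ofNat_encode]
    exact hsub F (List.subset_append_left _ _) (by simp [L])
  · rw [belowCode, Denumerable.ofNat_encode]
    exact hsub G (List.subset_append_right _ _) (by simp [L])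

/-- The words occurring in `I` form a set `A` closed under confirmation, and each word of `A` has a
proper extension in `A` confirming any given word of `A`. A branch through `A` that confirms all of
`A` is a name by totality, and the named point has exactly the words of `A`. -/
theorem IsMeetRelation.exists_meetIdeal_eq (hR : IsMeetRelation δ R) (htot : δ.IsTotal)
    {I : Set ℕ} (hI : IsRoundedIdeal (belowCode R) I) : ∃ x, meetIdeal δ x = I := by
  classical
  let A : Set (List ℕ) := {w | ∃ n ∈ I, w ∈ Denumerable.ofNat (List (List ℕ)) n}
  have hup : ∀ n ∈ I, ∃ m ∈ I, belowCode R n m := fun n hn => by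
    obtain ⟨m, hm, h, -⟩ := hI.2.2 n n hn hn
    exact ⟨m, hm, h⟩
  have hlen : ∀ N, ∃ n ∈ I, N ≤ (Denumerable.ofNat (List (List ℕ)) n).length := by
    intro N
    induction N with
    | zero =>
      obtain ⟨n, hn⟩ := hI.1
      exact ⟨n, hn, Nat.zero_le _⟩
    | succ N ih =>
      obtain ⟨n, hn, h⟩ := ih
      obtain ⟨m, hm, hnm⟩ := hup n hn
      exact ⟨m, hm, h.trans_lt (below_iff.1 hnm).2.1⟩
  have hcover : ∀ F : List (List ℕ), (∀ w ∈ F, w ∈ A) →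
      ∃ n ∈ I, F ⊆ Denumerable.ofNat (List (List ℕ)) n := by
    intro F hF
    induction F with
    | nil =>
      obtain ⟨n, hn⟩ := hI.1
      exact ⟨n, hn, List.nil_subset _⟩
    | cons w F ih =>
      obtain ⟨n, hn, h⟩ := ih fun w hw => hF w (List.mem_cons_of_mem _ hw)
      obtain ⟨m, hm, hw⟩ := hF w List.mem_cons_self
      obtain ⟨z, hz, hnz, hmz⟩ := hI.2.2 n m hn hm
      exact ⟨z, hz, List.cons_subset.2 ⟨(below_iff.1 hmz).1 hw,
        fun _ h' => (below_iff.1 hnz).1 (h h')⟩⟩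
  have hmem : ∀ F : List (List ℕ), (∀ w ∈ F, w ∈ A) → Encodable.encode F ∈ I := by
    intro F hF
    obtain ⟨n, hn, hFn⟩ := hcover F hF
    obtain ⟨m, hm, hlm⟩ := hlen F.length
    obtain ⟨z, hz, hnz, hmz⟩ := hI.2.2 n m hn hm
    obtain ⟨y, hy, hzy⟩ := hup z hz
    have hFz := List.Subset.trans hFn (below_iff.1 hnz).1
    have hl := (below_iff.1 hmz).2.1
    obtain ⟨h1, h2, h3, h4, h5⟩ := below_iff.1 hzy
    -- The clauses relating `z` to `y` are inherited by any list whose words occur in `z` and which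
    -- is no longer than `z`.
    refine hI.2.1 _ _ hy (below_iff.2 ?_)
    rw [Denumerable.ofNat_encode]
    exact ⟨List.Subset.trans hFz h1, by omega, h3,
      fun v hv w hw => h4 v (hFz hv) w (by omega), fun u hu w hw => h5 u (hFz hu) w (hFz hw)⟩
  have hnext : ∀ F : List (List ℕ), (∀ w ∈ F, w ∈ A) →
      ∃ G : List (List ℕ), (∀ w ∈ G, w ∈ A) ∧ below R F G = true := by
    intro F hF
    obtain ⟨m, hm, h⟩ := hup _ (hmem F hF)
    rw [belowCode, Denumerable.ofNat_encode] at h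
    exact ⟨_, fun w hw => ⟨m, hm, hw⟩, h⟩
  have hnil : [] ∈ A := by
    obtain ⟨G, hG, h⟩ := hnext [] (by simp)
    exact hG _ (below_iff.1 h).2.2.1
  have hext : ∀ u ∈ A, ∀ w ∈ A, ∃ v ∈ A, w <+: v ∧ w.length < v.length ∧ R (u, v) = true := by
    intro u hu w hw
    obtain ⟨G, hG, h⟩ := hnext [u, w] (by simp [hu, hw])
    obtain ⟨v, hv, h⟩ := (below_iff.1 h).2.2.2.2 u (by simp) w (by simp)
    exact ⟨v, hG v hv, h⟩
  have hclosed : ∀ v ∈ A, ∀ w, R (w, v) = true → w ∈ A := by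
    intro v hv w hw
    -- Repeating `v` makes the list long enough for the code of `w` to fall below its length.
    obtain ⟨G, hG, h⟩ := hnext (List.replicate (Encodable.encode w + 1) v)
      fun w hw => (List.eq_of_mem_replicate hw) ▸ hv
    exact hG w ((below_iff.1 h).2.2.2.1 v (by simp) w (by simp) hw)
  have hstep : ∀ (w : A) (k : ℕ), ∃ v : A, w.1 <+: v.1 ∧ w.1.length < v.1.length ∧
      (Denumerable.ofNat (List ℕ) k ∈ A → R (Denumerable.ofNat (List ℕ) k, v.1) = true) := by
    intro w k
    by_cases hk : Denumerable.ofNat (List ℕ) k ∈ A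
    · obtain ⟨v, hv, h1, h2, h3⟩ := hext _ hk _ w.2
      exact ⟨⟨v, hv⟩, h1, h2, fun _ => h3⟩
    · obtain ⟨v, hv, h1, h2, -⟩ := hext _ w.2 _ w.2
      exact ⟨⟨v, hv⟩, h1, h2, fun h => (hk h).elim⟩
  choose next n1 n2 n3 using hstep
  -- Step `k` confirms the word with code `k` if it belongs to `A`, so every word of `A` is
  -- confirmed along the branch.
  let s (k : ℕ) : A := Nat.rec ⟨[], hnil⟩ (fun k w => next w k) k
  have hs : ∀ k, k ≤ (s k).1.length := by
    intro k
    induction k with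
    | zero => exact Nat.zero_le _
    | succ k ih => exact ih.trans_lt (n2 (s k) k)
  obtain ⟨p, hp⟩ := exists_limit_word (fun k => (s k).1) (fun k => n1 (s k) k)
    fun n => ⟨n, hs n⟩
  obtain ⟨x, hx⟩ := htot p
  have hA : ∀ w, w ∈ A ↔ Meets δ w x := by
    intro w
    rw [hR.meets_iff hx]
    constructor
    · intro hw
      have h := n3 (s (Encodable.encode w)) (Encodable.encode w)
      rw [Denumerable.ofNat_encode] at h
      exact ⟨_, hp (Encodable.encode w + 1) ▸ h hw⟩
    · rintro ⟨k, hk⟩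
      refine hclosed (s k).1 (s k).2 w (hR.mono _ _ _ ?_ hk)
      rw [hp k]
      exact pre_prefix_pre p (hs k)
  refine ⟨x, Set.ext fun n => ⟨fun hn => ?_, fun hn w hw => (hA w).1 ⟨n, hn, hw⟩⟩⟩
  have := hmem (Denumerable.ofNat (List (List ℕ)) n) fun w hw => (hA w).2 (hn w hw)
  rwa [Denumerable.encode_ofNat] at this

/-- Membership of a point in an open set is decided by a finite prefix of a name. Two points with
the same words therefore have the same neighbourhoods. -/
theorem meetIdeal_injective (h : Function.Injective (nhdFilter δ)) :
    Function.Injective (meetIdeal δ) := by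
  have key : ∀ x y, meetIdeal δ x = meetIdeal δ y → ∀ U : Opens δ, U.1 x → U.1 y := by
    intro x y hxy U hU
    obtain ⟨g, Hg⟩ := U.2
    obtain ⟨p, hp⟩ := δ.surj x
    obtain ⟨k, m, hm, hm0⟩ := (Hg.open_iff hp).1 hU
    have h1 : Encodable.encode [pre p k] ∈ meetIdeal δ x :=
      encode_mem_meetIdeal.2 (by simpa using meets_pre hp k)
    rw [hxy, encode_mem_meetIdeal] at h1
    obtain ⟨p', hp', hpre⟩ := h1 _ List.mem_cons_self
    rw [length_pre] at hpre
    exact (Hg.open_iff hp').2 ⟨k, m, hpre ▸ hm, hm0⟩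
  intro x y hxy
  refine h (Subtype.ext (funext fun U => propext ?_))
  exact ⟨key x y hxy U, key y x hxy.symm U⟩

/-- Forwards, one lists the finite lists all of whose words are confirmed. Backwards, the singleton
lists in the ideal enumerate the words that extend to names of `x`; an open set contains `x` exactly
when such a word hits it. This computes the neighbourhood filter, and admissibility turns it into a
name. -/
theorem IsMeetRelation.computablyIsomorphic (hR : IsMeetRelation δ R) (htot : δ.IsTotal)
    (hadm : ComputablyAdmissible δ) : ComputablyIsomorphic δ (roundedIdeals (belowCode R)) := by
  let e : X ≃ {I : Set ℕ // IsRoundedIdeal (belowCode R) I} :=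
    Equiv.ofBijective (fun x => ⟨meetIdeal δ x, hR.isRoundedIdeal x⟩)
      ⟨fun x y hxy => meetIdeal_injective hadm.1 (congrArg Subtype.val hxy), fun I => by
        obtain ⟨x, hx⟩ := hR.exists_meetIdeal_eq htot I.2
        exact ⟨x, Subtype.ext hx⟩⟩
  refine ⟨e, ?_, ?_⟩
  · have hRp := hR.primrec
    have hP : REPred fun x : ℕ × List ℕ =>
        ((Denumerable.ofNat (List (List ℕ)) x.1).all fun w => R (w, x.2)) = true :=
      rePred_of_bool (Primrec.to_comp (primrec_all (by fun_prop) (by fun_prop)))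
    obtain ⟨h, hh, H⟩ := exists_computable_enum hP
    refine ⟨h, hh, fun p x hp _ => ?_⟩
    obtain ⟨q, hq, hqI⟩ := H p (e x).1 fun n => by
      simp only [List.all_eq_true]
      change (∀ w ∈ Denumerable.ofNat (List (List ℕ)) n, Meets δ w x) ↔ _
      simp only [hR.meets_iff hp]
      generalize Denumerable.ofNat (List (List ℕ)) n = F
      constructor
      · intro hF
        induction F with
        | nil => exact ⟨0, by simp⟩
        | cons w F ih =>
          obtain ⟨k, hk⟩ := ih fun w hw => hF w (List.mem_cons_of_mem _ hw)
          obtain ⟨l, hl⟩ := hF w List.mem_cons_self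
          refine ⟨max k l, fun v hv => ?_⟩
          rcases List.mem_cons.1 hv with rfl | hv
          · exact hR.mono _ _ _ (pre_prefix_pre p (le_max_right _ _)) hl
          · exact hR.mono _ _ _ (pre_prefix_pre p (le_max_left _ _)) (hk v hv)
      · rintro ⟨k, hk⟩ w hw
        exact ⟨k, hk w hw⟩
    exact ⟨q, hq, _, rfl, hqI⟩
  · have hP : REPred fun x : List ℕ × List ℕ =>
        ∃ w, (decide (Encodable.encode [w] + 1 ∈ x.1) && hit x.2 w) = true :=
      (rePred_of_bool (f := fun y : (List ℕ × List ℕ) × List ℕ =>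
        decide (Encodable.encode [y.2] + 1 ∈ y.1.1) && hit y.1.2 y.2)
        (Primrec.to_comp (by fun_prop))).exists_list
    obtain ⟨h, hh, H⟩ := exists_computable_curry (X := Opens δ) hP
    have key : IsComputable (roundedIdeals (belowCode R)) (opens (opens δ))
        fun I => nhdFilter δ (e.symm I) := by
      refine ⟨h, hh, fun p I hp _ => ?_⟩
      obtain ⟨x, rfl⟩ := e.surjective I
      have hx : nhdFilter δ (e.symm (e x)) = nhdFilter δ x := by rw [e.symm_apply_apply]
      obtain ⟨q, hq, Hq⟩ := H p
      have hp : ∀ n, n ∈ meetIdeal δ x ↔ ∃ i, p i = n + 1 := hp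
      have hmem : ∀ w, Meets δ w x ↔ ∃ k, Encodable.encode [w] + 1 ∈ pre p k := by
        intro w
        have := (encode_mem_meetIdeal (δ := δ) (F := [w]) (x := x)).symm.trans (hp _)
        simp only [List.mem_singleton, forall_eq] at this
        rw [this]
        constructor
        · rintro ⟨i, hi⟩
          exact ⟨i + 1, hi ▸ List.mem_of_getElem? (getElem?_pre (Nat.lt_succ_self i))⟩
        · rintro ⟨k, hk⟩
          obtain ⟨i, -, hi⟩ := List.mem_map.1 hk
          exact ⟨i, hi⟩
      refine ⟨q, hq, nhdFilter δ x, hx.symm, Hq (opens δ) (fun U => U.1 x) fun u U hu => ?_⟩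
      simp only [Bool.and_eq_true, decide_eq_true_eq]
      constructor
      · intro hU
        obtain ⟨p', hp'⟩ := δ.surj x
        obtain ⟨l, j, hl⟩ := (Opens.names_iff hu hp').1 hU
        obtain ⟨k, hk⟩ := (hmem _).1 (meets_pre hp' j)
        exact ⟨k, l, _, hk, hl⟩
      · rintro ⟨k, l, w, hk, hl⟩
        obtain ⟨p', hp', hpre⟩ := (hmem w).2 ⟨k, hk⟩
        exact (Opens.names_iff hu hp').2 ⟨l, w.length, by rwa [hpre]⟩
    have := IsComputableMulti.comp_left key hadm.2
    have hsingle : ∀ I, {x | nhdFilter δ x = nhdFilter δ (e.symm I)} = {e.symm I} := fun I =>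
      Set.ext fun x => hadm.1.eq_iff
    simp only [hsingle] at this
    exact this

end Ideals

/-! ### Transfer to equivalent representations, and the dense sequence. -/

theorem ComputablyIsomorphic.of_equivalent {X Y : Type*} {δ δ' : Representation X}
    {δY : Representation Y} (h : Equivalent δ δ') (h' : ComputablyIsomorphic δ' δY) :
    ComputablyIsomorphic δ δY := by
  obtain ⟨e, he, he'⟩ := h'
  exact ⟨e, he.comp h.1, h.2.comp he'⟩

/-- The points named by eventually zero sequences form a dense computable sequence. -/
theorem Equivalent.effectivelySeparable {X : Type*} {δ δ' : Representation X}
    (h : Equivalent δ δ') (htot : δ'.IsTotal) : EffectivelySeparable δ := by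
  choose a ha using fun n => htot (extendZero (Denumerable.ofNat (List ℕ) n))
  have hcomp : IsComputable nat δ' a := by
    -- The empty prefix is excluded because its default letter `0` need not be the number being
    -- named.
    have hP : REPred fun x : List ℕ × (ℕ × ℕ) => decide (x.1 ≠ [] ∧
        (Denumerable.ofNat (List ℕ) (x.1.getD 0 0)).getD x.2.1 0 = x.2.2) = true := by
      refine rePred_of_bool (Primrec.to_comp ?_)
      have : Primrec fun x : List ℕ × (ℕ × ℕ) => decide (x.1 ≠ []) &&
        decide ((Denumerable.ofNat (List ℕ) (x.1.getD 0 0)).getD x.2.1 0 = x.2.2) := by fun_prop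
      exact this.of_eq fun x => by simp
    obtain ⟨g, hg, Hg⟩ := exists_computable_of_graph hP
    refine ⟨g, hg, fun p n hp _ => ⟨_, Hg p _ fun m b => ?_, a n, rfl, ha n⟩⟩
    obtain rfl : p 0 = n := hp
    have hk : ∀ k, (pre p (k + 1)).getD 0 0 = p 0 := fun k => extendZero_pre (Nat.succ_pos k)
    simp only [decide_eq_true_eq]
    constructor
    · rintro rfl
      refine ⟨1, by simp [pre], ?_⟩
      rw [hk]
      rfl
    · rintro ⟨k, hne, hb⟩
      rcases k with _ | k
      · simp [pre] at hne
      · rw [hk] at hb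
        exact hb
  refine ⟨a, h.2.comp hcomp, fun U ⟨x, hx⟩ => ?_⟩
  obtain ⟨g, Hg⟩ := U.2
  obtain ⟨t, -, Ht⟩ := h.2
  obtain ⟨p, hp⟩ := δ'.surj x
  obtain ⟨q, hq, _, rfl, hqx⟩ := Ht p x hp ⟨_, rfl⟩
  obtain ⟨k, m, hm, hm0⟩ := (Hg.open_iff hqx).1 hx
  obtain ⟨j, hj⟩ := hq.2 k
  refine ⟨Encodable.encode (pre p j), ?_⟩
  have hname := ha (Encodable.encode (pre p j))
  obtain ⟨q', hq', _, rfl, hqa⟩ := Ht _ _ hname ⟨_, rfl⟩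
  refine (Hg.open_iff hqa).2 ⟨k, m, ?_, hm0⟩
  have h1 := hq.1 j
  have h2 := hq'.1 j
  have h3 := pre_extendZero (pre p j)
  rw [length_pre] at h3
  rw [Denumerable.ofNat_encode, h3] at h2
  -- The two names translate to sequences agreeing up to `k`, since the translation has already
  -- produced `k` letters from their common prefix of length `j`.
  have h4 : pre q k = pre q' k := by
    have h5 := congrArg (List.take k) (h1.symm.trans h2)
    rwa [take_pre hj, take_pre hj] at h5
  rwa [← h4]

end RepSpace

theorem mainTheorem5 {X : Type*} [Nonempty X] (δX : RepSpace.Representation X) :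
    List.TFAE [
      RepSpace.PrecomputablyQuasiPolish δX ∧ RepSpace.EffectivelySeparable δX,
      RepSpace.PrecomputablyQuasiPolish δX ∧ RepSpace.ComputablyOvert δX,
      ∃ δ : RepSpace.Representation X, RepSpace.Equivalent δX δ ∧
        RepSpace.EffectivelyFiberOvert δ ∧ RepSpace.ComputablyAdmissible δ ∧ δ.IsTotal,
      ∃ r : ℕ → ℕ → Prop, (∀ a b c, r a b → r b c → r a c) ∧ RepSpace.IsCE₂ r ∧
        RepSpace.ComputablyIsomorphic δX (RepSpace.roundedIdeals r) ∧
        REPred (RepSpace.Extendable r)] := by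
  tfae_have 1 → 2 := fun h => ⟨h.1, h.2.computablyOvert⟩
  tfae_have 2 → 4 := fun ⟨⟨r, htrans, hr, hiso⟩, hov⟩ =>
    ⟨r, htrans, hr, hiso, hov.rePred_extendable hiso⟩
  tfae_have 4 → 3 := fun ⟨_, htrans, hr, hiso, hE⟩ =>
    RepSpace.exists_total_representation htrans hr hiso hE
  tfae_have 3 → 1 := by
    rintro ⟨δ, hδ, hov, hadm, htot⟩
    obtain ⟨R, hR⟩ := hov.exists_isMeetRelation
    exact ⟨⟨_, RepSpace.belowCode_trans, hR.isCE₂,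
      .of_equivalent hδ (hR.computablyIsomorphic htot hadm)⟩, hδ.effectivelySeparable htot⟩
  tfae_finish
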